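/- Conventions. Banach spaces are complex, and for $\omega>0$ put $\Sigma_\omega=\{z\in\mathbb C\setminus\{0\}: |\arg z|<\omega\}$. A closed, densely defined operator $A$ with dense range on a Banach space $X$ is *sectorial* if for some $\omega\in(0,\pi)$ $$(S_\omega)\qquad \sigma(A)\subset\overline{\Sigma_\omega}\quad\text{and}\quad \sup_{\lambda\notin\overline{\Sigma_{\omega+\varepsilon}}}\|\lambda R(\lambda,A)\|<\infty\ \text{ for all }\varepsilon>0,$$ where $R(\lambda,A)=(\lambda-A)^{-1}$; its sectorial angle is $\omega(A)=\inf\{\omega\in(0,\pi):(S_\omega)\text{ holds}\}$. A family $\mathcal T\subset\mathcal B(X)$ is *$\mathcal R$-bounded* if for some $q\in[1,\infty)$ there is $C\ge 0$ with $$\Big\|\sum_{k=1}^n r_kT_kx_k\Big\|_{L_q([0,1];X)}\le C\Big\|\sum_{k=1}^n r_kx_k\Big\|_{L_q([0,1];X)}$$ for all $n$, $T_1,\dots,T_n\in\mathcal T$ and $x_1,\dots,x_n\in X$, where $r_k(t)=\operatorname{sign}\sin(2^k\pi t)$. A sectorial operator $A$ is *$\mathcal R$-sectorial* if $\{\lambda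 R(\lambda,A):\lambda\notin\overline{\Sigma_\omega}\}$ is $\mathcal R$-bounded for some $\omega\in(\omega(A),\pi)$. For a Schauder basis $(f_m)_{m\ge1}$ of $X$ the *Schauder multiplier* associated to $(\gamma_m)_{m\ge1}\subset\mathbb C$ is the operator $\sum_m a_mf_m\mapsto\sum_m\gamma_ma_mf_m$ whose domain is the set of all $x=\sum_m a_mf_m$ for which $\sum_m\gamma_ma_mf_m$ converges. The Haar system on $[0,1]$ is $h_1=1$ and, for $n=2^k+s$ with $k\ge0$ and $1\le s\le 2^k$, $h_n=\mathbf 1_{[\frac{2s-2}{2^{k+1}},\frac{2s-1}{2^{k+1}})}-\mathbf 1_{[\frac{2s-1}{2^{k+1}},\frac{2s}{2^{k+1}})}$. **Theorem.** For every $p\in(2,\infty)$ there is a sectorial operator $A$ on $L_p([0,1])$ with $\omega(A)=0$ that is not $\mathcal R$-sectorial. Moreover, $A$ can be chosen as follows. Let $\tilde h_m=h_m/\|h_m\|_p$ be the normalized Haar system. There is a permutation $\pi$ of $\mathbb N=\{1,2,\dots\}$ fixing every odd number such that both $(\tilde h_{\pi(m)})_{m\ge1}$ and the sequence $$f_m=\begin{cases}\tilde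 h_{m}, & m\text{ odd},\\ \tilde h_{\pi(m)}+\tilde h_{m-1}, & m\text{ even},\end{cases}$$ are Schauder bases of $L_p([0,1])$, and $A$ is the Schauder multiplier associated to $(2^m)_{m\ge1}$ with respect to $(f_m)_{m\ge1}$. -/

import Mathlib

open MeasureTheory Set
open scoped ENNReal NNReal

noncomputable section

/-! ### Unbounded operators: resolvents and sectoriality -/

namespace SectorialOperators

variable {X : Type*} [NormedAddCommGroup X] [NormedSpace ℂ X]

/-- The open sector `Σ_ω = {z ≠ 0 : |arg z| < ω}`, with `arg z ∈ (-π, π]`. -/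
def sector (ω : ℝ) : Set ℂ := {z | z ≠ 0 ∧ |z.arg| < ω}

/-- `R` is the bounded two-sided inverse of `z - A : D(A) → X`. -/
def IsResolventAt (A : X →ₗ.[ℂ] X) (z : ℂ) (R : X →L[ℂ] X) : Prop :=
  (∀ x : X, ∃ h : R x ∈ A.domain, z • R x - A ⟨R x, h⟩ = x) ∧
    ∀ y : A.domain, R (z • (y : X) - A y) = y

/-- The spectrum `σ(A)`: all `z` for which `z - A` has no bounded inverse. -/
def spectrumOf (A : X →ₗ.[ℂ] X) : Set ℂ := {z | ¬ ∃ R : X →L[ℂ] X, IsResolventAt A z R}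

open Classical in
/-- The resolvent `R(z, A) = (z - A)⁻¹` for `z ∉ σ(A)` (and `0` for `z ∈ σ(A)`). -/
def resolventOp (A : X →ₗ.[ℂ] X) (z : ℂ) : X →L[ℂ] X :=
  if h : ∃ R : X →L[ℂ] X, IsResolventAt A z R then h.choose else 0

/-- The condition `(S_ω)`: `σ(A) ⊆ closure Σ_ω`, and for every `ε > 0` the operators `z R(z, A)`
are uniformly bounded for `z` outside `closure Σ_(ω + ε)`. -/
def SectorCondition (A : X →ₗ.[ℂ] X) (ω : ℝ) : Prop :=
  spectrumOf A ⊆ closure (sector ω) ∧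
    ∀ ε > 0, ∃ C : ℝ, ∀ z : ℂ, z ∉ closure (sector (ω + ε)) → ‖z • resolventOp A z‖ ≤ C

/-- A sectorial operator: closed, densely defined, with dense range, and satisfying `(S_ω)` for
some `ω ∈ (0, π)`. -/
structure IsSectorial (A : X →ₗ.[ℂ] X) : Prop where
  isClosed : A.IsClosed
  dense_domain : Dense (A.domain : Set X)
  dense_range : DenseRange A
  sector : ∃ ω ∈ Ioo 0 Real.pi, SectorCondition A ω

/-- The sectorial angle `ω(A)` of a sectorial operator. -/
def sectorialAngle (A : X →ₗ.[ℂ] X) : ℝ := sInf {ω | ω ∈ Ioo 0 Real.pi ∧ SectorCondition A ω}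

/-! ### `R`-boundedness and `R`-sectoriality -/

/-- The `k`-th Rademacher function `r_k(t) = sign (sin (2 ^ k π t))`, for `k ≥ 1`. -/
def rademacher (k : ℕ) (t : ℝ) : ℝ := Real.sign (Real.sin (2 ^ k * Real.pi * t))

/-- The norm in `L_q([0,1]; X)` of the Rademacher sum `∑ r_k x_k` (where `k = 1, …, n`). -/
def rademacherNorm (q : ℝ≥0∞) {n : ℕ} (x : Fin n → X) : ℝ≥0∞ :=
  eLpNorm (fun t : ℝ => ∑ k : Fin n, (rademacher ((k : ℕ) + 1) t : ℂ) • x k) q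
    (volume.restrict (Icc (0 : ℝ) 1))

/-- `R`-boundedness of a family of bounded operators. -/
def RBounded (𝒯 : Set (X →L[ℂ] X)) : Prop :=
  ∃ q : ℝ≥0∞, 1 ≤ q ∧ q ≠ ∞ ∧ ∃ C : ℝ≥0, ∀ (n : ℕ) (T : Fin n → X →L[ℂ] X) (x : Fin n → X),
    (∀ k, T k ∈ 𝒯) → rademacherNorm q (fun k => T k (x k)) ≤ C * rademacherNorm q x

/-- An `R`-sectorial operator: a sectorial operator such that `{z R(z, A) : z ∉ closure Σ_ω}` is
`R`-bounded for some `ω ∈ (ω(A), π)`. -/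
def IsRSectorial (A : X →ₗ.[ℂ] X) : Prop :=
  IsSectorial A ∧ ∃ ω ∈ Ioo (sectorialAngle A) Real.pi,
    RBounded {T : X →L[ℂ] X | ∃ z : ℂ, z ∉ closure (sector ω) ∧ T = z • resolventOp A z}

/-! ### Schauder multipliers -/

/-- The Schauder multiplier associated to `γ` with respect to the Schauder basis `b`: it sends
`x = ∑ a_m b_m` to `∑ γ_m a_m b_m`, and its domain consists of all `x` for which the latter series
converges (in the sense of convergence of the sequence of partial sums). -/
def schauderMultiplier (b : SchauderBasis ℂ X) (γ : ℕ → ℂ) : X →ₗ.[ℂ] X where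
  domain :=
    { carrier := {x | Summable (fun m => (γ m * b.coord m x) • b m)
        (SummationFilter.conditional ℕ)}
      zero_mem' := by simp
      add_mem' := fun {x y} hx hy => by
        have h := Summable.add hx hy
        simpa only [mem_ofPred_eq, map_add, mul_add, add_smul] using h
      smul_mem' := fun c x hx => by
        have h := Summable.const_smul c hx
        simpa only [mem_ofPred_eq, map_smul, smul_eq_mul, mul_left_comm, ← mul_smul] using h }
  toFun :=
    { toFun := fun x => ∑'[SummationFilter.conditional ℕ] m, (γ m * b.coord m (x : X)) • b m
      map_add' := fun x y => by
        have h := Summable.tsum_add x.2 y.2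
        simpa only [Submodule.coe_add, map_add, mul_add, add_smul] using h
      map_smul' := fun c x => by
        have h := Summable.tsum_const_smul c x.2
        simpa only [Submodule.coe_smul, map_smul, smul_eq_mul, mul_left_comm, ← mul_smul,
          RingHom.id_apply] using h }

/-! ### The Haar system -/

/-- The Haar system on `[0,1]`, indexed from `0`: `haar 0 = 1`, and for `n = 2 ^ k + s` with
`0 ≤ s < 2 ^ k` the function `haar n` is `1` on the left half and `-1` on the right half of
`[s / 2 ^ k, (s + 1) / 2 ^ k)`, and `0` elsewhere. -/
def haar (n : ℕ) : ℝ → ℂ :=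
  if n = 0 then fun _ => 1 else
    let k : ℕ := Nat.log 2 n
    let s : ℝ := n - 2 ^ k
    (Ico (2 * s / 2 ^ (k + 1)) ((2 * s + 1) / 2 ^ (k + 1))).indicator (fun _ => 1) -
      (Ico ((2 * s + 1) / 2 ^ (k + 1)) ((2 * s + 2) / 2 ^ (k + 1))).indicator (fun _ => 1)

/-- The complex Banach space `L_p([0,1])`. -/
abbrev LpUnit (p : ℝ≥0∞) : Type := Lp ℂ p (volume.restrict (Icc (0 : ℝ) 1))

theorem memLp_haar (p : ℝ≥0∞) (n : ℕ) : MemLp (haar n) p (volume.restrict (Icc (0 : ℝ) 1)) := by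
  have h : ∀ a b : ℝ, MemLp ((Ico a b).indicator (fun _ : ℝ => (1 : ℂ))) p
      (volume.restrict (Icc (0 : ℝ) 1)) := fun a b =>
    (memLp_const (1 : ℂ)).indicator measurableSet_Ico
  by_cases hn : n = 0
  · rw [haar, if_pos hn]
    exact memLp_const 1
  · rw [haar, if_neg hn]
    exact (h _ _).sub (h _ _)

/-- The normalized Haar system `h_n / ‖h_n‖_p` in `L_p([0,1])`. -/
def normalizedHaar (p : ℝ≥0∞) (n : ℕ) : LpUnit p :=
  ((‖(memLp_haar p n).toLp (haar n)‖⁻¹ : ℝ) : ℂ) • (memLp_haar p n).toLp (haar n)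

end SectorialOperators

end

/-!
# A sectorial operator on `L_p([0,1])` that is not `R`-sectorial

The multiplier by `2 ^ (m + 1)` on an arbitrary Schauder basis is sectorial of angle zero: off a
sector around the positive half-line the sequence `z / (z - 2 ^ (m + 1))` has uniformly bounded
variation, and by summation by parts such a sequence acts boundedly on any Schauder basis
(`exists_multiplier`, `exists_isResolventAt`). `R`-sectoriality, in contrast, is sensitive to the
basis. For the paired basis `f` with `f m = h m` (`m` even) and `f m = h m + h (m - 1)` (`m` odd) of
a normalized basis `h`, the operator `z R(z, A)` at `z = -2 ^ (m + 1)` maps `h m`, for `m` odd, to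
`h m / 2 - h (m - 1) / 6` (`smul_resolventOp_pairedBasis_apply`). An `R`-bound therefore controls
Rademacher sums of the vectors `a m • h (m - 1)` by those of the vectors `a m • h m`.

The vectors `h m` are a rearranged Haar system. Any rearrangement is admissible because for `p ≥ 2`
the Haar system is unconditional. This follows from Burkholder's function: in suitable coordinates
it is separately concave (`burkholder_add_add_sub_le`), one step of a Haar polynomial together with
its `±1` transform moves one coordinate only, and earlier Haar functions are constant on the support
of a later one. Hence Burkholder's function of the pair is at most a linear combination of Haar
functions of mean zero (`exists_burkholder_le`), and integrating gives the `L_p` bound.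

The permutation puts Haar functions with disjoint supports at the positions `m = 4 k + 3` and keeps
the Haar functions of index `4 k + 2` in place. With the coefficients `a m` making the latter
unnormalized Haar functions, signed sums of the `a m • h m` have norm at most `Q ^ (1 / p)`, where
`Q` is the total mass of the supports (`haarMass`), while by orthogonality in `L_2` signed sums of
the `a m • h (m - 1)` have norm at least `Q ^ (1 / 2)`. As `Q` is comparable to a harmonic sum it is
unbounded, and `p > 2` yields a contradiction.
-/

namespace SectorialOperators

open Filter Topology

/-! ### Schauder bases and their multipliers -/

section Schauder

variable {X : Type*} [NormedAddCommGroup X] [NormedSpace ℂ X]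

/-- Uniformly bounded operators which converge to the identity on a set with dense span converge
to the identity everywhere. -/
theorem tendsto_id_of_dense_span {P : ℕ → X →L[ℂ] X} {K : ℝ} (hP : ∀ N, ‖P N‖ ≤ K) {s : Set X}
    (hs : Dense (Submodule.span ℂ s : Set X))
    (h : ∀ x ∈ s, Tendsto (fun N => P N x) atTop (𝓝 x)) (x : X) :
    Tendsto (fun N => P N x) atTop (𝓝 x) := by
  have hspan : ∀ y ∈ Submodule.span ℂ s, Tendsto (fun N => P N y) atTop (𝓝 y) := by
    intro y hy
    induction hy using Submodule.span_induction with
    | mem y hy => exact h y hy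
    | zero => simp
    | add y z _ _ hy hz => simpa using hy.add hz
    | smul c y _ hy => simpa using hy.const_smul c
  have hK : 0 ≤ K := (norm_nonneg _).trans (hP 0)
  rw [Metric.tendsto_atTop]
  intro ε hε
  obtain ⟨y, hy, hxy⟩ := Metric.mem_closure_iff.1 (hs x) (ε / (2 * (K + 1))) (by positivity)
  obtain ⟨N, hN⟩ := Metric.tendsto_atTop.1 (hspan y hy) (ε / 2) (by positivity)
  refine ⟨N, fun n hn => ?_⟩
  have h1 := hN n hn
  rw [dist_eq_norm] at h1 hxy ⊢
  have h2 : P n x - x = P n (x - y) + (P n y - y) - (x - y) := by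
    rw [map_sub]; abel
  have h3 : ‖P n (x - y)‖ ≤ K * ‖x - y‖ :=
    ((P n).le_opNorm _).trans (mul_le_mul_of_nonneg_right (hP n) (norm_nonneg _))
  have h4 : (K + 1) * ‖x - y‖ < ε / 2 := by
    calc (K + 1) * ‖x - y‖ < (K + 1) * (ε / (2 * (K + 1))) := by gcongr
      _ = ε / 2 := by field_simp
  calc ‖P n x - x‖ ≤ ‖P n (x - y)‖ + ‖P n y - y‖ + ‖x - y‖ := by
        rw [h2]; exact (norm_sub_le _ _).trans (by gcongr; exact norm_add_le _ _)
    _ < ε := by nlinarith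

theorem hasSum_conditional_iff {E : Type*} [NormedAddCommGroup E] {u : ℕ → E} {x : E} :
    HasSum u x (SummationFilter.conditional ℕ) ↔
      Tendsto (fun N => ∑ m ∈ Finset.range N, u m) atTop (𝓝 x) := by
  rw [HasSum, SummationFilter.conditional_filter_eq_map_range, tendsto_map'_iff]
  rfl

/-- A biorthogonal system with dense span and uniformly bounded partial sum operators is a
Schauder basis. -/
def schauderBasisOfBounded (e : ℕ → X) (φ : ℕ → StrongDual ℂ X)
    (hφ : ∀ i j, φ i (e j) = if i = j then 1 else 0) {K : ℝ}
    (hK : ∀ N, ‖∑ i ∈ Finset.range N, (φ i).smulRight (e i)‖ ≤ K)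
    (hd : Dense (Submodule.span ℂ (range e) : Set X)) : SchauderBasis ℂ X where
  basis := e
  coord := φ
  ortho i j := by
    by_cases h : i = j <;> simp [hφ, h]
  expansion x := by
    rw [hasSum_conditional_iff]
    have := tendsto_id_of_dense_span hK hd (by
      rintro _ ⟨j, rfl⟩
      refine tendsto_const_nhds.congr' ?_
      filter_upwards [eventually_gt_atTop j] with N hN
      simp [hφ, hN]) x
    simpa [sum_apply] using this

variable (b : SchauderBasis ℂ X)

theorem coord_apply_basis (i j : ℕ) : b.coord i (b j) = if i = j then 1 else 0 := by
  by_cases h : i = j <;> simp [b.ortho, h]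

theorem coord_eq_of_hasSum {a : ℕ → ℂ} {x : X}
    (h : HasSum (fun m => a m • b m) x (SummationFilter.conditional ℕ)) (m : ℕ) :
    b.coord m x = a m := by
  rw [hasSum_conditional_iff] at h
  refine tendsto_nhds_unique (((b.coord m).continuous.tendsto x).comp h)
    (tendsto_const_nhds.congr' ?_)
  filter_upwards [eventually_gt_atTop m] with N hN
  simp [b.ortho, Pi.single_apply, hN]

/-- Summation by parts: a scalar sequence of bounded variation tending to `0` acts as a bounded
multiplier on every Schauder basis. -/
theorem exists_multiplier [CompleteSpace X] {K : ℝ} (hK : ∀ n, ‖b.proj n‖ ≤ K) {c : ℕ → ℂ} {V : ℝ}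
    (hc : Tendsto c atTop (𝓝 0)) (hs : Summable fun m => ‖c m - c (m + 1)‖)
    (hV : ∑' m, ‖c m - c (m + 1)‖ ≤ V) :
    ∃ M : X →L[ℂ] X, ‖M‖ ≤ K * V ∧
      ∀ x, HasSum (fun m => (c m * b.coord m x) • b m) (M x) (SummationFilter.conditional ℕ) := by
  have hK0 : 0 ≤ K := (norm_nonneg _).trans (hK 0)
  have hle : ∀ m, ‖(c m - c (m + 1)) • b.proj (m + 1)‖ ≤ K * ‖c m - c (m + 1)‖ := fun m => by
    rw [norm_smul, mul_comm]
    exact mul_le_mul_of_nonneg_right (hK _) (norm_nonneg _)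
  have hsum : Summable fun m => (c m - c (m + 1)) • b.proj (m + 1) :=
    Summable.of_norm_bounded (hs.mul_left K) hle
  refine ⟨∑' m, (c m - c (m + 1)) • b.proj (m + 1), ?_, fun x => ?_⟩
  · refine (tsum_of_norm_bounded (hs.mul_left K).hasSum hle).trans ?_
    rw [tsum_mul_left]
    exact mul_le_mul_of_nonneg_left hV hK0
  · have habel : ∀ N, ∑ m ∈ Finset.range N, (c m * b.coord m x) • b m =
        ∑ m ∈ Finset.range N, ((c m - c (m + 1)) • b.proj (m + 1)) x + c N • b.proj N x := by
      intro N
      induction N with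
      | zero => simp
      | succ N ih =>
        rw [Finset.sum_range_succ, ih, Finset.sum_range_succ]
        have h1 : b.proj (N + 1) x = b.proj N x + b.coord N x • b N := by
          rw [SchauderBasis.proj_apply, SchauderBasis.proj_apply, Finset.sum_range_succ]
        rw [smul_apply, h1, mul_smul, sub_smul, smul_add, smul_add]
        abel
    rw [hasSum_conditional_iff]
    simp only [habel]
    have h1 := (hsum.hasSum.mapL (ContinuousLinearMap.apply ℂ X x)).tendsto_sum_nat
    have h2 : Tendsto (fun N => c N • b.proj N x) atTop (𝓝 0) := by
      simpa using hc.smul (b.tendsto_proj x)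
    simpa using h1.add h2

/-- The multiplier by `(z - γ m)⁻¹` is the resolvent at `z` of the multiplier by `γ`. -/
theorem isResolventAt_schauderMultiplier {γ : ℕ → ℂ} {z : ℂ} (hz : ∀ m, z ≠ γ m)
    {M : X →L[ℂ] X} (hM : ∀ x, HasSum (fun m => ((z - γ m)⁻¹ * b.coord m x) • b m) (M x)
      (SummationFilter.conditional ℕ)) :
    IsResolventAt (schauderMultiplier b γ) z M := by
  have hz' : ∀ m, z - γ m ≠ 0 := fun m => sub_ne_zero.2 (hz m)
  refine ⟨fun x => ?_, fun y => ?_⟩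
  · have h : HasSum (fun m => (γ m * b.coord m (M x)) • b m) (z • M x - x)
        (SummationFilter.conditional ℕ) := by
      convert! ((hM x).const_smul z).sub (b.expansion x) using 2 with m
      rw [coord_eq_of_hasSum b (hM x) m, smul_smul, ← sub_smul]
      congr 1
      field_simp [hz' m]
      ring
    refine ⟨h.summable, ?_⟩
    have : schauderMultiplier b γ ⟨M x, h.summable⟩ = z • M x - x := h.tsum_eq
    rw [this, sub_sub_cancel]
  · have h1 : HasSum (fun m => (γ m * b.coord m (y : X)) • b m) (schauderMultiplier b γ y)
        (SummationFilter.conditional ℕ) := y.2.hasSum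
    have h2 : HasSum (fun m => ((z - γ m) * b.coord m (y : X)) • b m)
        (z • (y : X) - schauderMultiplier b γ y) (SummationFilter.conditional ℕ) := by
      convert! ((b.expansion (y : X)).const_smul z).sub h1 using 2 with m
      rw [smul_smul, ← sub_smul, sub_mul]
    have h3 := hM (z • (y : X) - schauderMultiplier b γ y)
    simp only [coord_eq_of_hasSum b h2, inv_mul_cancel_left₀ (hz' _)] at h3
    exact h3.unique (b.expansion _)

end Schauder

/-! ### Resolvents and sectors -/

section Resolvent

variable {X : Type*} [NormedAddCommGroup X] [NormedSpace ℂ X]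

theorem IsResolventAt.eq {A : X →ₗ.[ℂ] X} {z : ℂ} {R S : X →L[ℂ] X} (hR : IsResolventAt A z R)
    (hS : IsResolventAt A z S) : R = S := by
  ext x
  obtain ⟨h, hx⟩ := hS.1 x
  have := hR.2 ⟨S x, h⟩
  rwa [hx] at this

theorem IsResolventAt.resolventOp_eq {A : X →ₗ.[ℂ] X} {z : ℂ} {R : X →L[ℂ] X}
    (hR : IsResolventAt A z R) : resolventOp A z = R := by
  have h : ∃ R : X →L[ℂ] X, IsResolventAt A z R := ⟨R, hR⟩
  rw [resolventOp, dif_pos h]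
  exact h.choose_spec.eq hR

/-- An operator with a bounded resolvent at some point is closed. -/
theorem IsResolventAt.isClosed {A : X →ₗ.[ℂ] X} {z : ℂ} {R : X →L[ℂ] X}
    (hR : IsResolventAt A z R) : A.IsClosed := by
  have : (A.graph : Set (X × X)) = {q | R (z • q.1 - q.2) = q.1} := by
    ext ⟨x, y⟩
    simp only [SetLike.mem_coe, LinearPMap.mem_graph_iff, mem_ofPred_eq]
    constructor
    · rintro ⟨w, rfl, rfl⟩
      exact hR.2 w
    · intro hq
      obtain ⟨h, hx⟩ := hR.1 (z • x - y)
      refine ⟨⟨_, h⟩, hq, ?_⟩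
      have hx' : A ⟨R (z • x - y), h⟩ = z • R (z • x - y) - (z • x - y) := by
        have hc := sub_sub_cancel (z • R (z • x - y)) (A ⟨R (z • x - y), h⟩)
        rw [hx] at hc
        exact hc.symm
      rw [hx', hq, sub_sub_cancel]
  rw [LinearPMap.IsClosed, this]
  exact isClosed_eq (by fun_prop) (by fun_prop)

theorem zero_mem_closure_sector {ω : ℝ} (hω : 0 < ω) : (0 : ℂ) ∈ closure (sector ω) := by
  refine mem_closure_of_tendsto (f := fun n : ℕ => (((1 : ℝ) / ((n : ℝ) + 1) : ℝ) : ℂ))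
    (b := atTop) ?_ (Eventually.of_forall fun n => ?_)
  · have := (Complex.continuous_ofReal.tendsto 0).comp
      (tendsto_one_div_add_atTop_nhds_zero_nat (𝕜 := ℝ))
    simpa [Function.comp_def] using this
  · have h : (0 : ℝ) < 1 / ((n : ℝ) + 1) := by positivity
    exact ⟨by exact_mod_cast h.ne', by rw [Complex.arg_ofReal_of_nonneg h.le]; simpa⟩

theorem ne_zero_and_le_abs_arg_of_notMem_closure {ω : ℝ} (hω : 0 < ω) {z : ℂ}
    (hz : z ∉ closure (sector ω)) : z ≠ 0 ∧ ω ≤ |z.arg| := by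
  have h0 : z ≠ 0 := fun h => hz (h ▸ zero_mem_closure_sector hω)
  exact ⟨h0, not_lt.1 fun h => hz (subset_closure ⟨h0, h⟩)⟩

theorem neg_ofReal_notMem_closure_sector {ω : ℝ} (h0 : 0 ≤ ω) (hω : ω < Real.pi) {t : ℝ}
    (ht : 0 < t) : (-(t : ℂ)) ∉ closure (sector ω) := by
  have hsub : closure (sector ω) ⊆ {z : ℂ | Real.cos ω * ‖z‖ ≤ z.re} := by
    refine closure_minimal (fun z hz => ?_) (isClosed_le (by fun_prop) Complex.continuous_re)
    have hcos : Real.cos ω ≤ Real.cos z.arg := by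
      rw [← Real.cos_abs z.arg]
      exact Real.cos_le_cos_of_nonneg_of_le_pi (abs_nonneg _) hω.le hz.2.le
    have := mul_le_mul_of_nonneg_right hcos (norm_nonneg z)
    rwa [Complex.cos_arg hz.1, div_mul_cancel₀ _ (norm_ne_zero_iff.2 hz.1)] at this
  intro h
  have h1 := hsub h
  simp only [mem_ofPred_eq, norm_neg, Complex.norm_real, Complex.neg_re, Complex.ofReal_re,
    Real.norm_eq_abs, abs_of_pos ht] at h1
  have h2 : Real.cos Real.pi < Real.cos ω := Real.cos_lt_cos_of_nonneg_of_le_pi h0 le_rfl hω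
  rw [Real.cos_pi] at h2
  nlinarith

/-- Outside a sector around the positive half-line, `|z - t|` dominates `|z| + t`. -/
theorem exists_mul_le_norm_sub {θ : ℝ} (hθ : 0 < θ) (hθ' : θ ≤ Real.pi) :
    ∃ κ : ℝ, 0 < κ ∧ ∀ z : ℂ, z ≠ 0 → θ ≤ |z.arg| → ∀ t : ℝ, 0 ≤ t →
      κ * (‖z‖ + t) ≤ ‖z - t‖ := by
  have hc : Real.cos θ < 1 := by
    simpa using Real.cos_lt_cos_of_nonneg_of_le_pi le_rfl hθ' hθ
  have hc' := Real.neg_one_le_cos θ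
  refine ⟨√((1 - Real.cos θ) / 2), Real.sqrt_pos.2 (by linarith), fun z hz hzθ t ht => ?_⟩
  have hcos : Real.cos z.arg ≤ Real.cos θ := by
    rw [← Real.cos_abs z.arg]
    exact Real.cos_le_cos_of_nonneg_of_le_pi hθ.le (Complex.abs_arg_le_pi z) hzθ
  have hre : z.re = ‖z‖ * Real.cos z.arg := (Complex.norm_mul_cos_arg z).symm
  refine le_of_sq_le_sq ?_ (norm_nonneg _)
  rw [mul_pow, Real.sq_sqrt (by linarith)]
  have h1 : ‖z - t‖ ^ 2 = ‖z‖ ^ 2 - 2 * t * z.re + t ^ 2 := by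
    rw [Complex.sq_norm, Complex.sq_norm, Complex.normSq_apply, Complex.normSq_apply]
    simp
    ring
  rw [h1, hre]
  have h2 : ‖z‖ * t * Real.cos z.arg ≤ ‖z‖ * t * Real.cos θ := by gcongr
  nlinarith [mul_nonneg (by linarith : 0 ≤ 1 + Real.cos θ) (sq_nonneg (‖z‖ - t))]

end Resolvent

/-! ### Multipliers with increasing symbols are sectorial of angle zero -/

section Multiplier

variable {X : Type*} [NormedAddCommGroup X] [NormedSpace ℂ X] [CompleteSpace X]

/-- The resolvent bound for the multiplier with symbol increasing to infinity: the variation of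
`(z - γ m)⁻¹` is dominated by a telescoping series. -/
theorem exists_isResolventAt (b : SchauderBasis ℂ X) {K : ℝ} (hK : ∀ n, ‖b.proj n‖ ≤ K)
    {γ : ℕ → ℝ} (h0 : 0 < γ 0) (hmono : Monotone γ) (htop : Tendsto γ atTop atTop) {κ : ℝ}
    (hκ : 0 < κ) {z : ℂ} (hz : ∀ m, κ * (‖z‖ + γ m) ≤ ‖z - γ m‖) :
    ∃ R, IsResolventAt (schauderMultiplier b fun m => (γ m : ℂ)) z R ∧ ‖z • R‖ ≤ K * (κ ^ 2)⁻¹ := by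
  have hγ : ∀ m, 0 < γ m := fun m => h0.trans_le (hmono (Nat.zero_le m))
  have hpos : ∀ m, 0 < ‖z‖ + γ m := fun m => add_pos_of_nonneg_of_pos (norm_nonneg _) (hγ m)
  have hne : ∀ m, z - γ m ≠ 0 := fun m => norm_pos_iff.1 ((mul_pos hκ (hpos m)).trans_le (hz m))
  set c : ℕ → ℂ := fun m => (z - γ m)⁻¹ with hcdef
  set d : ℕ → ℝ := fun m => (κ ^ 2)⁻¹ * (‖z‖ + γ m)⁻¹ with hd
  have htop' : Tendsto (fun m => ‖z‖ + γ m) atTop atTop := tendsto_atTop_add_const_left _ _ htop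
  have hd0 : Tendsto d atTop (𝓝 0) := by
    simpa using (tendsto_inv_atTop_zero.comp htop').const_mul (κ ^ 2)⁻¹
  have hcn : ∀ m, ‖c m‖ ≤ κ⁻¹ * (‖z‖ + γ m)⁻¹ := fun m => by
    rw [hcdef, norm_inv, ← mul_inv]
    exact inv_anti₀ (mul_pos hκ (hpos m)) (hz m)
  have hc0 : Tendsto c atTop (𝓝 0) := by
    refine squeeze_zero_norm hcn ?_
    simpa using (tendsto_inv_atTop_zero.comp htop').const_mul κ⁻¹
  have hle : ∀ m, ‖c m - c (m + 1)‖ ≤ d m - d (m + 1) := fun m => by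
    have h1 : c m - c (m + 1) = ((γ m - γ (m + 1) : ℝ) : ℂ) * (c m * c (m + 1)) := by
      simp only [hcdef]
      field_simp [hne m, hne (m + 1)]
      push_cast
      ring
    have h2 : d m - d (m + 1) = (γ (m + 1) - γ m) *
        ((κ⁻¹ * (‖z‖ + γ m)⁻¹) * (κ⁻¹ * (‖z‖ + γ (m + 1))⁻¹)) := by
      simp only [hd]
      field_simp [(hpos m).ne', (hpos (m + 1)).ne', hκ.ne']
      ring
    have h3 : 0 ≤ γ (m + 1) - γ m := sub_nonneg.2 (hmono (Nat.le_succ m))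
    rw [h1, h2, norm_mul, norm_mul, Complex.norm_real, Real.norm_eq_abs, abs_sub_comm,
      abs_of_nonneg h3]
    have := hcn m
    have := hcn (m + 1)
    have := hpos m
    gcongr
  -- The dominating series telescopes.
  have hsum : HasSum (fun m => d m - d (m + 1)) (d 0) := by
    have hanti : ∀ m, 0 ≤ d m - d (m + 1) := fun m => (norm_nonneg _).trans (hle m)
    rw [hasSum_iff_tendsto_nat_of_nonneg hanti]
    simpa only [Finset.sum_range_sub', sub_zero] using hd0.const_sub (d 0)
  have hs : Summable fun m => ‖c m - c (m + 1)‖ :=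
    Summable.of_nonneg_of_le (fun _ => norm_nonneg _) hle hsum.summable
  obtain ⟨M, hM, hMx⟩ := exists_multiplier b hK hc0 hs
    ((hs.tsum_le_tsum hle hsum.summable).trans hsum.tsum_eq.le)
  refine ⟨M, isResolventAt_schauderMultiplier b (fun m => sub_ne_zero.1 (hne m)) hMx, ?_⟩
  have hK0 : 0 ≤ K := (norm_nonneg _).trans (hK 0)
  calc ‖z • M‖ = ‖z‖ * ‖M‖ := norm_smul _ _
    _ ≤ ‖z‖ * (K * ((κ ^ 2)⁻¹ * (‖z‖ + γ 0)⁻¹)) := by gcongr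
    _ = K * (κ ^ 2)⁻¹ * (‖z‖ * (‖z‖ + γ 0)⁻¹) := by ring
    _ ≤ K * (κ ^ 2)⁻¹ * 1 := by
        gcongr
        rw [← div_eq_mul_inv, div_le_one (hpos 0)]
        linarith
    _ = _ := mul_one _

variable (b : SchauderBasis ℂ X) {γ : ℕ → ℝ} (h0 : 0 < γ 0) (hmono : Monotone γ)
  (htop : Tendsto γ atTop atTop)

include h0 hmono htop

theorem sectorCondition_schauderMultiplier {ω : ℝ} (hω : 0 < ω) :
    SectorCondition (schauderMultiplier b fun m => (γ m : ℂ)) ω := by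
  obtain ⟨K, hK⟩ := b.exists_norm_proj_le
  have hγ : ∀ m, 0 ≤ γ m := fun m => (h0.trans_le (hmono (Nat.zero_le m))).le
  -- A single constant serves for all points outside a closed sector of angle `θ`.
  have key : ∀ θ : ℝ, 0 < θ → ∃ κ : ℝ, 0 < κ ∧ ∀ z : ℂ, z ∉ closure (sector θ) →
      ∃ R, IsResolventAt (schauderMultiplier b fun m => (γ m : ℂ)) z R ∧
        ‖z • R‖ ≤ K * (κ ^ 2)⁻¹ := by
    intro θ hθ
    obtain ⟨κ, hκ, h⟩ := exists_mul_le_norm_sub (lt_min hθ Real.pi_pos) (min_le_right θ Real.pi)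
    refine ⟨κ, hκ, fun z hz => ?_⟩
    obtain ⟨hz0, hzθ⟩ := ne_zero_and_le_abs_arg_of_notMem_closure hθ hz
    exact exists_isResolventAt b hK h0 hmono htop hκ
      fun m => h z hz0 ((min_le_left _ _).trans hzθ) _ (hγ m)
  refine ⟨fun z hz => ?_, fun ε hε => ?_⟩
  · by_contra hzc
    obtain ⟨κ, -, h⟩ := key ω hω
    obtain ⟨R, hR, -⟩ := h z hzc
    exact hz ⟨R, hR⟩
  · obtain ⟨κ, -, h⟩ := key (ω + ε) (by linarith)
    refine ⟨K * (κ ^ 2)⁻¹, fun z hz => ?_⟩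
    obtain ⟨R, hR, hRn⟩ := h z hz
    rwa [hR.resolventOp_eq]

theorem isSectorial_schauderMultiplier :
    IsSectorial (schauderMultiplier b fun m => (γ m : ℂ)) := by
  obtain ⟨K, hK⟩ := b.exists_norm_proj_le
  have hγ : ∀ m, 0 < γ m := fun m => h0.trans_le (hmono (Nat.zero_le m))
  obtain ⟨R, hR, -⟩ := exists_isResolventAt b hK h0 hmono htop one_pos (z := 0) fun m => by
    simp [abs_of_pos (hγ m)]
  -- The resolvent at `0` exists, so the range is the whole space.
  refine ⟨hR.isClosed, ?_, ?_, Real.pi / 2, ⟨by positivity, by linarith [Real.pi_pos]⟩,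
    sectorCondition_schauderMultiplier b h0 hmono htop (by positivity)⟩
  · intro x
    refine mem_closure_of_tendsto (b.tendsto_proj x) (Eventually.of_forall fun N => ?_)
    rw [SchauderBasis.proj_apply]
    refine Submodule.sum_mem _ fun i _ => Submodule.smul_mem _ _ ?_
    refine (hasSum_conditional_iff (x := (γ i : ℂ) • b i)).2
      (tendsto_const_nhds.congr' ?_) |>.summable
    filter_upwards [eventually_gt_atTop i] with N hN
    simp [b.ortho, Pi.single_apply, hN]
  · refine Function.Surjective.denseRange fun x => ?_
    obtain ⟨h, hx⟩ := hR.1 (-x)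
    exact ⟨⟨_, h⟩, by simpa using hx⟩

theorem sectorialAngle_schauderMultiplier :
    sectorialAngle (schauderMultiplier b fun m => (γ m : ℂ)) = 0 := by
  have : {ω | ω ∈ Ioo 0 Real.pi ∧
      SectorCondition (schauderMultiplier b fun m => (γ m : ℂ)) ω} = Ioo 0 Real.pi := by
    ext ω
    exact ⟨fun h => h.1, fun h => ⟨h, sectorCondition_schauderMultiplier b h0 hmono htop h.1⟩⟩
  rw [sectorialAngle, this, csInf_Ioo Real.pi_pos]

/-- The operators `z R(z, A)` at `z = -t` act on the basis vectors by `t / (t + γ m)`. -/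
theorem smul_resolventOp_neg_apply_basis {t : ℝ} (ht : 0 < t) (m : ℕ) :
    ((-(t : ℂ)) • resolventOp (schauderMultiplier b fun m => (γ m : ℂ)) (-(t : ℂ))) (b m) =
      ((t / (t + γ m) : ℝ) : ℂ) • b m := by
  obtain ⟨K, hK⟩ := b.exists_norm_proj_le
  have hγ : ∀ m, 0 < γ m := fun m => h0.trans_le (hmono (Nat.zero_le m))
  have hnorm : ∀ m, ‖(-(t : ℂ)) - γ m‖ = t + γ m := fun m => by
    rw [← neg_add', norm_neg, ← Complex.ofReal_add, Complex.norm_real, Real.norm_eq_abs,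
      abs_of_pos (add_pos ht (hγ m))]
  obtain ⟨R, hR, -⟩ := exists_isResolventAt b hK h0 hmono htop one_pos (z := -(t : ℂ)) fun m => by
    rw [hnorm m]
    simp [abs_of_pos ht]
  rw [hR.resolventOp_eq]
  have hs : HasSum (fun n => ((γ n : ℂ) * b.coord n (b m)) • b n) ((γ m : ℂ) • b m)
      (SummationFilter.conditional ℕ) := by
    refine hasSum_conditional_iff.2 (tendsto_const_nhds.congr' ?_)
    filter_upwards [eventually_gt_atTop m] with N hN
    simp [b.ortho, Pi.single_apply, hN]
  have h2 := hR.2 ⟨b m, hs.summable⟩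
  have h3 : schauderMultiplier b (fun m => (γ m : ℂ)) ⟨b m, hs.summable⟩ = (γ m : ℂ) • b m :=
    hs.tsum_eq
  rw [h3, ← sub_smul, map_smul] at h2
  have hne : (t : ℂ) + γ m ≠ 0 := by
    exact_mod_cast (add_pos ht (hγ m)).ne'
  have h4 : ((t / (t + γ m) : ℝ) : ℂ) • ((-(t : ℂ) - γ m) • R (b m)) = (-(t : ℂ)) • R (b m) := by
    rw [smul_smul]
    congr 1
    push_cast
    field_simp
    ring
  rw [smul_apply, ← h4, h2]

end Multiplier

/-! ### Pairing up a basis -/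

section Paired

variable {X : Type*} [NormedAddCommGroup X] [NormedSpace ℂ X]

/-- For a normalized Schauder basis `h`, the vectors `h 0, h 1 + h 0, h 2, h 3 + h 2, …` form a
Schauder basis: its partial sum operators differ from those of `h` by at most one coordinate,
moved to the preceding basis vector. -/
noncomputable def pairedBasis (h : SchauderBasis ℂ X) (hn : ∀ m, ‖h m‖ = 1) :
    SchauderBasis ℂ X where
  basis m := if Even m then h m else h m + h (m - 1)
  coord m := if Even m then h.coord m - h.coord (m + 1) else h.coord m
  ortho i j := by
    have key : (if Even i then h.coord i - h.coord (i + 1) else h.coord i)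
        (if Even j then h j else h j + h (j - 1)) = if i = j then (1 : ℂ) else 0 := by
      rcases Nat.even_or_odd' i with ⟨a, rfl | rfl⟩ <;>
        rcases Nat.even_or_odd' j with ⟨c, rfl | rfl⟩ <;>
        simp [coord_apply_basis] <;> grind
    rw [key]
    by_cases hij : i = j <;> simp [hij]
  expansion x := by
    have hsum : ∀ N, ∑ m ∈ Finset.range N, (if Even m then h.coord m - h.coord (m + 1)
          else h.coord m) x • (if Even m then h m else h m + h (m - 1)) =
        h.proj N x - if Even N then 0 else h.coord N x • h (N - 1) := by
      intro N
      induction N with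
      | zero => simp
      | succ N ih =>
        rw [Finset.sum_range_succ, ih, SchauderBasis.proj_apply, SchauderBasis.proj_apply,
          Finset.sum_range_succ]
        by_cases hN : Even N
        · simp only [hN, Nat.even_add_one, if_true, not_true_eq_false, if_false, sub_apply,
            sub_smul, Nat.add_sub_cancel]
          abel
        · simp only [hN, Nat.even_add_one, not_false_eq_true, if_true, if_false, smul_add]
          abel
    rw [hasSum_conditional_iff]
    simp only [hsum]
    have h1 : Tendsto (fun N => h.proj (N + 1) x - h.proj N x) atTop (𝓝 0) := by
      simpa using ((tendsto_add_atTop_iff_nat 1).2 (h.tendsto_proj x)).sub (h.tendsto_proj x)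
    have h2 : Tendsto (fun N => if Even N then 0 else h.coord N x • h (N - 1)) atTop (𝓝 0) := by
      refine squeeze_zero_norm (fun N => ?_) (by simpa using h1.norm)
      rw [Finset.sum_range_succ, add_sub_cancel_left, norm_smul, hn]
      split_ifs
      · simp
      · rw [norm_smul, hn]
    simpa using (h.tendsto_proj x).sub h2

theorem pairedBasis_apply (h : SchauderBasis ℂ X) (hn : ∀ m, ‖h m‖ = 1) (m : ℕ) :
    pairedBasis h hn m = if Even m then h m else h m + h (m - 1) := rfl

/-- The resolvent of the multiplier by `2 ^ (m + 1)` with respect to the paired basis mixes the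
vectors `h m` and `h (m - 1)` of the original basis: at `z = -2 ^ (m + 1)` the eigenvalues of
`z R(z, A)` on `h m + h (m - 1)` and on `h (m - 1)` are `1 / 2` and `2 / 3`. -/
theorem smul_resolventOp_pairedBasis_apply [CompleteSpace X] (h : SchauderBasis ℂ X)
    (hn : ∀ m, ‖h m‖ = 1) {m : ℕ} (hm : ¬ Even m) :
    ((-((2 ^ (m + 1) : ℝ) : ℂ)) • resolventOp (schauderMultiplier (pairedBasis h hn)
      fun m => ((2 ^ (m + 1) : ℝ) : ℂ)) (-((2 ^ (m + 1) : ℝ) : ℂ))) (h m) =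
      (2⁻¹ : ℂ) • h m - (6⁻¹ : ℂ) • h (m - 1) := by
  obtain ⟨n, rfl⟩ := Nat.exists_eq_succ_of_ne_zero (show m ≠ 0 from fun h0 => hm (by simp [h0]))
  have hev : Even n := by
    rw [Nat.succ_eq_add_one, Nat.even_add_one, not_not] at hm
    exact hm
  have hmono : Monotone fun m : ℕ => (2 : ℝ) ^ (m + 1) := fun a b hab =>
    pow_le_pow_right₀ one_le_two (by omega)
  have htop : Tendsto (fun m : ℕ => (2 : ℝ) ^ (m + 1)) atTop atTop :=
    (tendsto_add_atTop_iff_nat 1).2 (tendsto_pow_atTop_atTop_of_one_lt one_lt_two)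
  have key := smul_resolventOp_neg_apply_basis (pairedBasis h hn)
    (γ := fun m => (2 : ℝ) ^ (m + 1)) (by norm_num) hmono htop
    (t := 2 ^ (n.succ + 1)) (by positivity)
  have h1 := key n
  have h2 := key n.succ
  rw [pairedBasis_apply, if_pos hev] at h1
  rw [pairedBasis_apply, if_neg hm, Nat.succ_sub_one, map_add, h1] at h2
  have e1 : (2 : ℝ) ^ (n.succ + 1) / (2 ^ (n.succ + 1) + 2 ^ (n + 1)) = 2 / 3 := by
    rw [Nat.succ_eq_add_one, pow_succ _ (n + 1), div_eq_div_iff (by positivity) (by positivity)]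
    ring
  have e2 : (2 : ℝ) ^ (n.succ + 1) / (2 ^ (n.succ + 1) + 2 ^ (n.succ + 1)) = 1 / 2 := by
    rw [div_eq_div_iff (by positivity) (by positivity)]
    ring
  rw [e1, e2, ← eq_sub_iff_add_eq] at h2
  rw [h2, Nat.succ_sub_one, smul_add, add_sub_assoc, ← sub_smul, sub_eq_add_neg (_ • _), ← neg_smul]
  congr 2
  · norm_num
  · push_cast
    norm_num

end Paired

/-! ### Burkholder's function -/

/-- Burkholder's function in the coordinates `u = x + y`, `v = x - y`, up to a positive constant. In
these coordinates a step of a martingale and of its `±1` transform moves only one variable. -/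
noncomputable def burkholder (p u v : ℝ) : ℝ :=
  max |u| |v| ^ (p - 1) * (max |u| |v| - p / 2 * |u + v|)

section Burkholder

variable {p : ℝ}

theorem continuous_burkholder (hp : 2 ≤ p) :
    Continuous fun q : ℝ × ℝ => burkholder p q.1 q.2 := by
  have h : Continuous fun q : ℝ × ℝ => max |q.1| |q.2| ^ (p - 1) :=
    Continuous.rpow_const (by fun_prop) fun _ => Or.inr (by linarith)
  unfold burkholder
  fun_prop

theorem burkholder_comm (u v : ℝ) : burkholder p u v = burkholder p v u := by
  rw [burkholder, burkholder, max_comm, add_comm]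

theorem burkholder_mul (hp : 2 ≤ p) (t u v : ℝ) :
    burkholder p (t * u) (t * v) = |t| ^ p * burkholder p u v := by
  have h1 : max |t * u| |t * v| = |t| * max |u| |v| := by
    rw [abs_mul, abs_mul, mul_max_of_nonneg _ _ (abs_nonneg t)]
  have h2 : |t| ^ p = |t| ^ (p - 1) * |t| := by
    conv_lhs => rw [show p = (p - 1) + 1 by ring]
    rw [Real.rpow_add_one' (abs_nonneg t) (by linarith)]
  have h3 : 0 ≤ max |u| |v| := (abs_nonneg u).trans (le_max_left _ _)
  rw [burkholder, burkholder, h1, ← mul_add, abs_mul, Real.mul_rpow (abs_nonneg t) h3, h2]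
  ring

theorem burkholder_zero_right_nonpos (hp : 2 ≤ p) (u : ℝ) : burkholder p u 0 ≤ 0 := by
  rw [burkholder, abs_zero, add_zero, max_eq_left (abs_nonneg u)]
  refine mul_nonpos_of_nonneg_of_nonpos (by positivity) ?_
  nlinarith [abs_nonneg u]

/-- Burkholder's function majorizes `|y| ^ p - C |x| ^ p` up to a constant, where `u = x + y` and
`v = x - y`. -/
theorem half_rpow_le_burkholder_add (hp : 2 ≤ p) (u v : ℝ) :
    (|u - v| / 2) ^ p / 2 ≤ burkholder p u v + p ^ p * |u + v| ^ p := by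
  set M := max |u| |v| with hM
  set s := |u + v| with hs
  have hM0 : 0 ≤ M := (abs_nonneg u).trans (le_max_left _ _)
  have hs0 : 0 ≤ s := abs_nonneg _
  have hd : |u - v| / 2 ≤ M := by
    have := abs_sub u v
    have := le_max_left |u| |v|
    have := le_max_right |u| |v|
    linarith
  have h1 : (|u - v| / 2) ^ p ≤ M ^ p := Real.rpow_le_rpow (by positivity) hd (by linarith)
  have hpow : ∀ x : ℝ, 0 ≤ x → x ^ (p - 1) * x = x ^ p := fun x hx => by
    rw [← Real.rpow_add_one' hx (by linarith), sub_add_cancel]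
  have hW : burkholder p u v = M ^ p - p / 2 * s * M ^ (p - 1) := by
    rw [burkholder, ← hM, ← hs, ← hpow M hM0]
    ring
  rw [hW, ← Real.mul_rpow (by linarith) hs0]
  rcases le_total (p * s) M with h | h
  · have h2 : p * s * M ^ (p - 1) ≤ M ^ p := by
      rw [← hpow M hM0, mul_comm]
      gcongr
    have h3 : 0 ≤ (p * s) ^ p := by positivity
    linarith
  · have h2 : M ^ p ≤ (p * s) ^ p := Real.rpow_le_rpow hM0 h (by linarith)
    have h3 : p * s * M ^ (p - 1) ≤ (p * s) ^ p := by
      rw [← hpow (p * s) (by positivity), mul_comm]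
      gcongr
      linarith
    have h4 : 0 ≤ M ^ p := by positivity
    linarith

/-- For `|u| ≤ 1` the function `burkholder p u 1` is affine in `u`. The deviation from this affine
function is `burkholderTail p 1 u` for `u ≥ 1` and `burkholderTail p (-1) (-u)` for `u ≤ -1`. -/
noncomputable def burkholderTail (p s w : ℝ) : ℝ :=
  (1 - p / 2) * w ^ p - s * (p / 2) * w ^ (p - 1) - 1 + p / 2 * (s * w + 1)

theorem hasDerivAt_burkholderTail {s w : ℝ} (hw : 0 < w) :
    HasDerivAt (burkholderTail p s)
      (p / 2 * (s - (p - 2) * w ^ (p - 1) - s * (p - 1) * w ^ (p - 2))) w := by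
  have h1 := (Real.hasDerivAt_rpow_const (p := p) (Or.inl hw.ne')).const_mul (1 - p / 2)
  have h2 := (Real.hasDerivAt_rpow_const (p := p - 1) (Or.inl hw.ne')).const_mul (s * (p / 2))
  have h3 := (((hasDerivAt_id w).const_mul s).add_const 1).const_mul (p / 2)
  have := ((h1.sub h2).sub_const 1).add h3
  convert! this using 1
  rw [show p - 1 - 1 = p - 2 by ring]
  ring

theorem antitoneOn_deriv_burkholderTail (hp : 2 ≤ p) {s : ℝ} (hs : -1 ≤ s) :
    AntitoneOn (fun w : ℝ => p / 2 * (s - (p - 2) * w ^ (p - 1) - s * (p - 1) * w ^ (p - 2)))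
      (Ici 1) := by
  have hd : ∀ w : ℝ, 0 < w → HasDerivAt
      (fun w : ℝ => p / 2 * (s - (p - 2) * w ^ (p - 1) - s * (p - 1) * w ^ (p - 2)))
      (-(p / 2 * (p - 1) * (p - 2) * w ^ (p - 3) * (w + s))) w := fun w hw => by
    have h1 := (Real.hasDerivAt_rpow_const (p := p - 1) (Or.inl hw.ne')).const_mul (p - 2)
    have h2 := (Real.hasDerivAt_rpow_const (p := p - 2) (Or.inl hw.ne')).const_mul (s * (p - 1))
    convert! ((h1.const_sub s).sub h2).const_mul (p / 2) using 1
    have h3 : w ^ (p - 1 - 1) = w ^ (p - 3) * w := by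
      rw [← Real.rpow_add_one hw.ne']
      congr 1
      ring
    rw [h3, show p - 2 - 1 = p - 3 by ring]
    ring
  refine antitoneOn_of_deriv_nonpos (convex_Ici 1)
    (fun w hw => (hd w (one_pos.trans_le hw)).continuousAt.continuousWithinAt)
    (fun w hw => ?_) (fun w hw => ?_)
  · rw [interior_Ici] at hw
    exact (hd w (one_pos.trans hw)).differentiableAt.differentiableWithinAt
  · rw [interior_Ici] at hw
    have hw1 : (1 : ℝ) < w := hw
    rw [(hd w (one_pos.trans hw1)).deriv, neg_nonpos]
    have h1 : 0 ≤ p - 1 := by linarith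
    have h2 : 0 ≤ p - 2 := by linarith
    have h3 : 0 ≤ w + s := by linarith
    have h4 : 0 ≤ p := by linarith
    positivity

theorem antitoneOn_burkholderTail (hp : 2 ≤ p) {s : ℝ} (hs : -1 ≤ s) :
    AntitoneOn (burkholderTail p s) (Ici 1) := by
  refine antitoneOn_of_deriv_nonpos (convex_Ici 1)
    (fun w hw => (hasDerivAt_burkholderTail
      (one_pos.trans_le hw)).continuousAt.continuousWithinAt)
    (fun w hw => ?_) (fun w hw => ?_)
  · rw [interior_Ici] at hw
    exact (hasDerivAt_burkholderTail (one_pos.trans hw)).differentiableAt.differentiableWithinAt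
  · rw [interior_Ici] at hw
    rw [(hasDerivAt_burkholderTail (one_pos.trans hw)).deriv]
    refine (antitoneOn_deriv_burkholderTail hp hs self_mem_Ici (mem_Ioi.1 hw).le
      (mem_Ioi.1 hw).le).trans ?_
    simp only [Real.one_rpow, mul_one]
    nlinarith [mul_nonneg (by linarith : 0 ≤ p - 2) (by linarith : 0 ≤ 1 + s)]

theorem concaveOn_burkholderTail (hp : 2 ≤ p) {s : ℝ} (hs : -1 ≤ s) :
    ConcaveOn ℝ (Ici 1) (burkholderTail p s) := by
  refine AntitoneOn.concaveOn_of_deriv (convex_Ici 1)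
    (fun w hw => (hasDerivAt_burkholderTail
      (one_pos.trans_le hw)).continuousAt.continuousWithinAt)
    (fun w hw => ?_) ?_
  · rw [interior_Ici] at hw
    exact (hasDerivAt_burkholderTail (one_pos.trans hw)).differentiableAt.differentiableWithinAt
  · rw [interior_Ici]
    refine ((antitoneOn_deriv_burkholderTail hp hs).mono Ioi_subset_Ici_self).congr
      fun w hw => ?_
    exact ((hasDerivAt_burkholderTail (one_pos.trans hw)).deriv).symm

theorem concaveOn_burkholderTail_max (hp : 2 ≤ p) {s : ℝ} (hs : -1 ≤ s) :
    ConcaveOn ℝ univ fun u : ℝ => burkholderTail p s (max u 1) := by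
  have himage : (fun u : ℝ => max u 1) '' univ = Ici 1 := by
    ext w
    refine ⟨?_, fun hw => ⟨w, mem_univ w, max_eq_left hw⟩⟩
    rintro ⟨u, -, rfl⟩
    exact le_max_right u 1
  exact ConcaveOn.comp_convexOn (g := burkholderTail p s) (f := fun u : ℝ => max u 1)
    (himage ▸ concaveOn_burkholderTail hp hs)
    ((convexOn_id convex_univ).sup (convexOn_const 1 convex_univ))
    (himage ▸ antitoneOn_burkholderTail hp hs)

theorem burkholder_one_right (hp : 2 ≤ p) (u : ℝ) :
    burkholder p u 1 = burkholderTail p 1 (max u 1) + burkholderTail p (-1) (max (-u) 1) +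
      (1 - p / 2 * (u + 1)) := by
  have h1 : ∀ s, burkholderTail p s 1 = 0 := fun s => by
    simp [burkholderTail]
    ring
  have hpow : ∀ x : ℝ, 0 ≤ x → x ^ (p - 1) * x = x ^ p := fun x hx => by
    rw [← Real.rpow_add_one' hx (by linarith), sub_add_cancel]
  rw [burkholder, abs_one]
  rcases le_total u (-1) with hu | hu
  · have e1 : |u| = -u := abs_of_nonpos (by linarith)
    have e2 : |u + 1| = -(u + 1) := abs_of_nonpos (by linarith)
    rw [max_eq_right (by linarith : u ≤ 1), h1, max_eq_left (by linarith : 1 ≤ -u), e1, e2,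
      max_eq_left (by linarith : 1 ≤ -u), burkholderTail, ← hpow (-u) (by linarith)]
    ring
  · rw [max_eq_right (by linarith : -u ≤ 1), h1, abs_of_nonneg (by linarith : 0 ≤ u + 1)]
    rcases le_total u 1 with hu' | hu'
    · rw [max_eq_right hu', h1, max_eq_right (abs_le.2 ⟨hu, hu'⟩), Real.one_rpow]
      ring
    · rw [abs_of_nonneg (by linarith : 0 ≤ u), max_eq_left hu', burkholderTail,
        ← hpow u (by linarith)]
      ring

theorem concaveOn_burkholder_one_right (hp : 2 ≤ p) :
    ConcaveOn ℝ univ fun u => burkholder p u 1 := by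
  have h1 := concaveOn_burkholderTail_max hp (s := 1) (by norm_num)
  have h2 := (concaveOn_burkholderTail_max hp (s := -1) le_rfl).comp_linearMap
    (-LinearMap.id : ℝ →ₗ[ℝ] ℝ)
  have h3 : ConcaveOn ℝ univ fun u : ℝ => 1 - p / 2 * (u + 1) := by
    refine ⟨convex_univ, fun x _ y _ a b _ _ hab => le_of_eq ?_⟩
    simp only [smul_eq_mul]
    linear_combination (1 - p / 2) * hab
  rw [show (fun u => burkholder p u 1) = _ from funext (burkholder_one_right hp)]
  exact (h1.add h2).add h3

/-- The key property of Burkholder's function: midpoint concavity in one variable. -/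
theorem burkholder_add_add_sub_le (hp : 2 ≤ p) (u v a : ℝ) :
    burkholder p (u + a) v + burkholder p (u - a) v ≤ 2 * burkholder p u v := by
  have hc := continuous_burkholder hp
  have hclosed : IsClosed {v : ℝ | burkholder p (u + a) v + burkholder p (u - a) v ≤
      2 * burkholder p u v} := by
    refine isClosed_le ?_ ?_
    · exact (hc.comp (by fun_prop : Continuous fun v : ℝ => (u + a, v))).add
        (hc.comp (by fun_prop : Continuous fun v : ℝ => (u - a, v)))
    · exact (hc.comp (by fun_prop : Continuous fun v : ℝ => (u, v))).const_mul 2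
  have hne : ({0}ᶜ : Set ℝ) ⊆ {v : ℝ | burkholder p (u + a) v + burkholder p (u - a) v ≤
      2 * burkholder p u v} := by
    intro v hv
    have hv0 : v ≠ 0 := hv
    have hhom : ∀ x, burkholder p x v = |v| ^ p * burkholder p (x / v) 1 := fun x => by
      rw [← burkholder_mul hp, mul_div_cancel₀ x hv0, mul_one]
    have := (concaveOn_burkholder_one_right hp).2 (mem_univ ((u + a) / v))
      (mem_univ ((u - a) / v)) (by norm_num : (0 : ℝ) ≤ 1 / 2) (by norm_num : (0 : ℝ) ≤ 1 / 2)
      (by norm_num)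
    simp only [smul_eq_mul] at this
    rw [show 1 / 2 * ((u + a) / v) + 1 / 2 * ((u - a) / v) = u / v by ring] at this
    simp only [mem_ofPred_eq, hhom]
    have hv1 : 0 ≤ |v| ^ p := by positivity
    nlinarith
  have := closure_minimal hne hclosed
  rw [(dense_compl_singleton (0 : ℝ)).closure_eq] at this
  exact this (mem_univ v)

end Burkholder

/-! ### Dyadic intervals and the Haar system -/

/-- The dyadic interval `[a / 2 ^ k, (a + 1) / 2 ^ k)`. -/
def dyadic (k a : ℕ) : Set ℝ := Ico (a / 2 ^ k) ((a + 1) / 2 ^ k)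

theorem mem_dyadic {k a : ℕ} {x : ℝ} : x ∈ dyadic k a ↔ ⌊(2 : ℝ) ^ k * x⌋ = (a : ℤ) := by
  have h : (0 : ℝ) < 2 ^ k := by positivity
  rw [dyadic, mem_Ico, div_le_iff₀ h, lt_div_iff₀ h, Int.floor_eq_iff, mul_comm x]
  simp

theorem measurableSet_dyadic (k a : ℕ) : MeasurableSet (dyadic k a) := measurableSet_Ico

theorem floor_two_pow_mul {j k : ℕ} (h : j ≤ k) (x : ℝ) :
    ⌊(2 : ℝ) ^ j * x⌋ = ⌊(2 : ℝ) ^ k * x⌋ / 2 ^ (k - j) := by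
  have h1 : (2 : ℝ) ^ j * x = 2 ^ k * x / ((2 ^ (k - j) : ℕ) : ℝ) := by
    rw [eq_div_iff (by positivity)]
    push_cast
    rw [mul_right_comm, ← pow_add, Nat.add_sub_cancel' h]
  rw [h1, Int.floor_div_natCast]
  push_cast
  rfl

/-- Dyadic intervals are nested or disjoint. -/
theorem mem_dyadic_iff_of_mem {j k a c : ℕ} {x y : ℝ} (h : j ≤ k) (hx : x ∈ dyadic k a)
    (hy : y ∈ dyadic k a) : x ∈ dyadic j c ↔ y ∈ dyadic j c := by
  rw [mem_dyadic] at hx hy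
  rw [mem_dyadic, mem_dyadic, floor_two_pow_mul h x, floor_two_pow_mul h y, hx, hy]

theorem mem_dyadic_iff_succ {k a : ℕ} {x : ℝ} :
    x ∈ dyadic k a ↔ x ∈ dyadic (k + 1) (2 * a) ∨ x ∈ dyadic (k + 1) (2 * a + 1) := by
  simp only [mem_dyadic, floor_two_pow_mul (Nat.le_succ k) x]
  push_cast
  simp only [Nat.succ_eq_add_one, Nat.add_sub_cancel_left, pow_one]
  omega

theorem eq_of_mem_dyadic {k a c : ℕ} {x : ℝ} (ha : x ∈ dyadic k a) (hc : x ∈ dyadic k c) :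
    a = c := by
  rw [mem_dyadic] at ha hc
  exact_mod_cast ha.symm.trans hc

theorem dyadic_subset_Icc {k a : ℕ} (ha : a < 2 ^ k) : dyadic k a ⊆ Icc 0 1 := by
  intro x hx
  have h : (0 : ℝ) < 2 ^ k := by positivity
  refine ⟨le_trans (by positivity) hx.1, hx.2.le.trans ?_⟩
  rw [div_le_one h]
  exact_mod_cast ha

/-- Lebesgue measure on the unit interval. -/
noncomputable abbrev unitVolume : Measure ℝ := volume.restrict (Icc (0 : ℝ) 1)

instance : IsProbabilityMeasure unitVolume := ⟨by simp⟩

theorem unitVolume_dyadic {k a : ℕ} (ha : a < 2 ^ k) :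
    unitVolume (dyadic k a) = ENNReal.ofReal ((2 ^ k)⁻¹) := by
  rw [Measure.restrict_apply (measurableSet_dyadic k a),
    inter_eq_left.2 (dyadic_subset_Icc ha), dyadic, Real.volume_Ico]
  congr 1
  rw [← sub_div, add_sub_cancel_left, one_div]

/-- The position `s` of the Haar function with index `2 ^ k + s` within its level. -/
def haarPos (n : ℕ) : ℕ := n - 2 ^ Nat.log 2 n

theorem two_pow_log_add_haarPos {n : ℕ} (hn : n ≠ 0) : 2 ^ Nat.log 2 n + haarPos n = n :=
  Nat.add_sub_cancel' (Nat.pow_log_le_self 2 hn)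

theorem haarPos_lt (n : ℕ) : haarPos n < 2 ^ Nat.log 2 n := by
  have := Nat.lt_pow_succ_log_self one_lt_two n
  rw [pow_succ] at this
  have := Nat.two_pow_pos (Nat.log 2 n)
  unfold haarPos
  omega

/-- The support of the Haar function with index `n ≠ 0`. -/
def haarSupport (n : ℕ) : Set ℝ := dyadic (Nat.log 2 n) (haarPos n)

/-- The Haar functions as real-valued functions. -/
noncomputable def haarReal (n : ℕ) (x : ℝ) : ℝ := (haar n x).re

open Classical in
theorem haar_apply {n : ℕ} (hn : n ≠ 0) (x : ℝ) :
    haar n x = if x ∈ dyadic (Nat.log 2 n + 1) (2 * haarPos n) then 1 else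
      if x ∈ dyadic (Nat.log 2 n + 1) (2 * haarPos n + 1) then -1 else 0 := by
  have hs : (n : ℝ) - 2 ^ Nat.log 2 n = haarPos n := by
    rw [haarPos, Nat.cast_sub (Nat.pow_log_le_self 2 hn)]
    push_cast
    rfl
  have h1 : Ico (2 * (haarPos n : ℝ) / 2 ^ (Nat.log 2 n + 1))
      ((2 * (haarPos n : ℝ) + 1) / 2 ^ (Nat.log 2 n + 1)) =
      dyadic (Nat.log 2 n + 1) (2 * haarPos n) := by
    rw [dyadic]
    push_cast
    rfl
  have h2 : Ico ((2 * (haarPos n : ℝ) + 1) / 2 ^ (Nat.log 2 n + 1))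
      ((2 * (haarPos n : ℝ) + 2) / 2 ^ (Nat.log 2 n + 1)) =
      dyadic (Nat.log 2 n + 1) (2 * haarPos n + 1) := by
    rw [dyadic]
    push_cast
    congr 2
    ring
  simp only [haar, if_neg hn, hs, h1, h2, Pi.sub_apply, indicator_apply]
  by_cases hx : x ∈ dyadic (Nat.log 2 n + 1) (2 * haarPos n)
  · have hx' : x ∉ dyadic (Nat.log 2 n + 1) (2 * haarPos n + 1) := fun h => by
      have := eq_of_mem_dyadic hx h
      omega
    simp [hx, hx']
  · by_cases hx' : x ∈ dyadic (Nat.log 2 n + 1) (2 * haarPos n + 1) <;> simp [hx, hx']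

theorem haar_zero_apply (x : ℝ) : haar 0 x = 1 := by simp [haar]

theorem ofReal_haarReal (n : ℕ) (x : ℝ) : ((haarReal n x : ℝ) : ℂ) = haar n x := by
  rw [haarReal]
  rcases eq_or_ne n 0 with rfl | hn
  · simp [haar_zero_apply]
  · rw [haar_apply hn]
    split_ifs <;> simp

theorem haarReal_zero_apply (x : ℝ) : haarReal 0 x = 1 := by simp [haarReal, haar_zero_apply]

open Classical in
theorem haarReal_apply {n : ℕ} (hn : n ≠ 0) (x : ℝ) :
    haarReal n x = if x ∈ dyadic (Nat.log 2 n + 1) (2 * haarPos n) then 1 else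
      if x ∈ dyadic (Nat.log 2 n + 1) (2 * haarPos n + 1) then -1 else 0 := by
  rw [haarReal, haar_apply hn]
  split_ifs <;> simp

theorem haarReal_of_notMem {n : ℕ} (hn : n ≠ 0) {x : ℝ} (hx : x ∉ haarSupport n) :
    haarReal n x = 0 := by
  rw [haarSupport, mem_dyadic_iff_succ, not_or] at hx
  rw [haarReal_apply hn, if_neg hx.1, if_neg hx.2]

theorem haarReal_of_mem {n : ℕ} (hn : n ≠ 0) {x : ℝ} (hx : x ∈ haarSupport n) :
    haarReal n x = 1 ∨ haarReal n x = -1 := by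
  rw [haarReal_apply hn]
  rw [haarSupport, mem_dyadic_iff_succ] at hx
  split_ifs with h1 h2
  · exact Or.inl rfl
  · exact Or.inr rfl
  · exact (hx.elim h1 h2).elim

/-- Each Haar function is constant on the support of every later one. -/
theorem haarReal_eq_of_mem {m n : ℕ} (hmn : m < n) {x y : ℝ} (hx : x ∈ haarSupport n)
    (hy : y ∈ haarSupport n) : haarReal m x = haarReal m y := by
  rcases eq_or_ne m 0 with rfl | hm
  · rw [haarReal_zero_apply, haarReal_zero_apply]
  have hlog : Nat.log 2 m ≤ Nat.log 2 n := Nat.log_mono_right hmn.le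
  rcases hlog.lt_or_eq with h | h
  · rw [haarReal_apply hm, haarReal_apply hm, mem_dyadic_iff_of_mem h hx hy,
      mem_dyadic_iff_of_mem h hx hy]
  · have hne : haarPos m ≠ haarPos n := by
      have := two_pow_log_add_haarPos hm
      have := two_pow_log_add_haarPos (Nat.ne_zero_of_lt hmn)
      rw [h] at *
      omega
    have hnot : ∀ z ∈ haarSupport n, z ∉ haarSupport m := fun z hz hz' => by
      rw [haarSupport, h] at hz'
      exact hne (eq_of_mem_dyadic hz' hz)
    rw [haarReal_of_notMem hm (hnot x hx), haarReal_of_notMem hm (hnot y hy)]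

theorem haarSupport_nonempty (n : ℕ) : (haarSupport n).Nonempty := by
  refine nonempty_Ico.2 ?_
  gcongr
  linarith

theorem measurableSet_haarSupport (n : ℕ) : MeasurableSet (haarSupport n) :=
  measurableSet_dyadic _ _

theorem unitVolume_haarSupport (n : ℕ) :
    unitVolume (haarSupport n) = ENNReal.ofReal ((2 ^ Nat.log 2 n)⁻¹) :=
  unitVolume_dyadic (haarPos_lt n)

theorem memLp_haarReal (q : ℝ≥0∞) (n : ℕ) : MemLp (haarReal n) q unitVolume :=
  (memLp_haar q n).re

theorem integrable_haarReal (n : ℕ) : Integrable (haarReal n) unitVolume :=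
  memLp_one_iff_integrable.1 (memLp_haarReal 1 n)

theorem integral_haarReal {n : ℕ} (hn : n ≠ 0) : ∫ x, haarReal n x ∂unitVolume = 0 := by
  have h : haarReal n = fun x =>
      (dyadic (Nat.log 2 n + 1) (2 * haarPos n)).indicator (fun _ => (1 : ℝ)) x -
      (dyadic (Nat.log 2 n + 1) (2 * haarPos n + 1)).indicator (fun _ => (1 : ℝ)) x := by
    funext x
    rw [haarReal_apply hn]
    by_cases hx : x ∈ dyadic (Nat.log 2 n + 1) (2 * haarPos n)
    · have hx' : x ∉ dyadic (Nat.log 2 n + 1) (2 * haarPos n + 1) := fun h => by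
        have := eq_of_mem_dyadic hx h
        omega
      simp [hx, hx']
    · by_cases hx' : x ∈ dyadic (Nat.log 2 n + 1) (2 * haarPos n + 1) <;> simp [hx, hx']
  have hlt := haarPos_lt n
  have hint : ∀ a, Integrable ((dyadic (Nat.log 2 n + 1) a).indicator fun _ => (1 : ℝ))
      unitVolume := fun a => (integrable_const 1).indicator (measurableSet_dyadic _ _)
  rw [h, integral_sub (hint _) (hint _), integral_indicator_const _ (measurableSet_dyadic _ _),
    integral_indicator_const _ (measurableSet_dyadic _ _), measureReal_def, measureReal_def,
    unitVolume_dyadic (by rw [pow_succ]; omega), unitVolume_dyadic (by rw [pow_succ]; omega),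
    sub_self]

theorem haarReal_mul_self {n : ℕ} (hn : n ≠ 0) (x : ℝ) :
    haarReal n x * haarReal n x = (haarSupport n).indicator (fun _ => 1) x := by
  by_cases hx : x ∈ haarSupport n
  · rw [indicator_of_mem hx]
    rcases haarReal_of_mem hn hx with h | h <;> rw [h] <;> norm_num
  · rw [indicator_of_notMem hx, haarReal_of_notMem hn hx, zero_mul]

/-- If `Ψ` depends on its first variable only through quantities that are constant on the support
of `haarReal n`, such as earlier Haar functions, then its odd part in the second variable, evaluated
at `haarReal n`, is a constant multiple of `haarReal n`. -/
theorem exists_sub_eq_mul_haarReal {n : ℕ} (hn : n ≠ 0) (Ψ : ℝ → ℝ → ℝ)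
    (hΨ : ∀ x ∈ haarSupport n, ∀ y ∈ haarSupport n, Ψ x = Ψ y) :
    ∃ c : ℝ, ∀ x, Ψ x (haarReal n x) - Ψ x (-haarReal n x) = c * haarReal n x := by
  obtain ⟨x₀, hx₀⟩ := haarSupport_nonempty n
  refine ⟨Ψ x₀ 1 - Ψ x₀ (-1), fun x => ?_⟩
  by_cases hx : x ∈ haarSupport n
  · rw [hΨ x hx x₀ hx₀]
    rcases haarReal_of_mem hn hx with h | h <;> rw [h]
    · ring
    · rw [neg_neg]
      ring
  · rw [haarReal_of_notMem hn hx]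
    simp

theorem integral_haarReal_mul_of_lt {m n : ℕ} (hmn : m < n) :
    ∫ x, haarReal m x * haarReal n x ∂unitVolume = 0 := by
  obtain ⟨x₀, hx₀⟩ := haarSupport_nonempty n
  have h : ∀ x, haarReal m x * haarReal n x = haarReal m x₀ * haarReal n x := fun x => by
    by_cases hx : x ∈ haarSupport n
    · rw [haarReal_eq_of_mem hmn hx hx₀]
    · rw [haarReal_of_notMem (Nat.ne_zero_of_lt hmn) hx, mul_zero, mul_zero]
  simp only [h]
  rw [integral_const_mul, integral_haarReal (Nat.ne_zero_of_lt hmn), mul_zero]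

theorem integral_haarReal_mul_self (n : ℕ) :
    ∫ x, haarReal n x * haarReal n x ∂unitVolume = (2 ^ Nat.log 2 n)⁻¹ := by
  rcases eq_or_ne n 0 with rfl | hn
  · simp [haarReal_zero_apply]
  · simp only [haarReal_mul_self hn]
    rw [integral_indicator_const _ (measurableSet_haarSupport n), measureReal_def,
      unitVolume_haarSupport, ENNReal.toReal_ofReal (by positivity), smul_eq_mul, mul_one]

theorem integral_haarReal_mul (m n : ℕ) : ∫ x, haarReal m x * haarReal n x ∂unitVolume =
    if m = n then (2 ^ Nat.log 2 n)⁻¹ else 0 := by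
  split_ifs with h
  · rw [h, integral_haarReal_mul_self]
  · rcases lt_or_gt_of_ne h with h | h
    · exact integral_haarReal_mul_of_lt h
    · simp only [mul_comm (haarReal m _)]
      exact integral_haarReal_mul_of_lt h

/-! ### Unconditionality of the Haar system for `p ≥ 2` -/

/-- The pointwise form of the martingale argument: Burkholder's function of a Haar polynomial and
its `±1` transform is dominated by a combination of Haar functions of mean zero. -/
theorem exists_burkholder_le {p : ℝ} (hp : 2 ≤ p) (a ε : ℕ → ℝ) (hε : ∀ n, ε n = 1 ∨ ε n = -1)
    (N : ℕ) : ∃ c : ℕ → ℝ, ∀ x,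
      burkholder p (∑ n ∈ Finset.range N, (1 + ε n) * a n * haarReal n x)
        (∑ n ∈ Finset.range N, (1 - ε n) * a n * haarReal n x) ≤
      ∑ n ∈ Finset.Ico 1 N, c n * haarReal n x := by
  induction N with
  | zero =>
    refine ⟨0, fun x => ?_⟩
    simpa using burkholder_zero_right_nonpos hp 0
  | succ N ih =>
    rcases Nat.eq_zero_or_pos N with rfl | hN
    -- The constant Haar function does not have mean zero; for it alone one of the arguments vanishes.
    · refine ⟨0, fun x => ?_⟩
      rcases hε 0 with h | h
      · simpa [h] using burkholder_zero_right_nonpos hp _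
      · rw [burkholder_comm]
        simpa [h] using burkholder_zero_right_nonpos hp _
    obtain ⟨c, hc⟩ := ih
    set U : ℝ → ℝ := fun x => ∑ n ∈ Finset.range N, (1 + ε n) * a n * haarReal n x with hU
    set V : ℝ → ℝ := fun x => ∑ n ∈ Finset.range N, (1 - ε n) * a n * haarReal n x with hV
    have hUc : ∀ x ∈ haarSupport N, ∀ y ∈ haarSupport N, U x = U y := fun x hx y hy =>
      Finset.sum_congr rfl fun n hn => by
        rw [haarReal_eq_of_mem (Finset.mem_range.1 hn) hx hy]
    have hVc : ∀ x ∈ haarSupport N, ∀ y ∈ haarSupport N, V x = V y := fun x hx y hy =>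
      Finset.sum_congr rfl fun n hn => by
        rw [haarReal_eq_of_mem (Finset.mem_range.1 hn) hx hy]
    -- Only one of the two arguments moves in the last step.
    obtain ⟨d, hd⟩ : ∃ d : ℝ, ∀ x, burkholder p (U x + (1 + ε N) * a N * haarReal N x)
        (V x + (1 - ε N) * a N * haarReal N x) ≤ burkholder p (U x) (V x) + d * haarReal N x := by
      rcases hε N with h | h
      · obtain ⟨d, hd⟩ := exists_sub_eq_mul_haarReal hN.ne'
          (fun x t => burkholder p (U x + 2 * a N * t) (V x)) fun x hx y hy => by
            simp only [hUc x hx y hy, hVc x hx y hy]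
        refine ⟨d / 2, fun x => ?_⟩
        have h1 := hd x
        have h2 := burkholder_add_add_sub_le hp (U x) (V x) (2 * a N * haarReal N x)
        simp only [mul_neg, ← sub_eq_add_neg] at h1
        rw [h, sub_self, zero_mul, zero_mul, add_zero, one_add_one_eq_two]
        linarith
      · obtain ⟨d, hd⟩ := exists_sub_eq_mul_haarReal hN.ne'
          (fun x t => burkholder p (V x + 2 * a N * t) (U x)) fun x hx y hy => by
            simp only [hUc x hx y hy, hVc x hx y hy]
        refine ⟨d / 2, fun x => ?_⟩
        have h1 := hd x
        have h2 := burkholder_add_add_sub_le hp (V x) (U x) (2 * a N * haarReal N x)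
        simp only [mul_neg, ← sub_eq_add_neg] at h1
        rw [h, sub_neg_eq_add, add_neg_cancel, zero_mul, zero_mul, add_zero, one_add_one_eq_two,
          burkholder_comm, burkholder_comm (U x)]
        linarith
    refine ⟨Function.update c N d, fun x => ?_⟩
    rw [Finset.sum_Ico_succ_top hN, Finset.sum_range_succ, Finset.sum_range_succ,
      Function.update_self]
    refine (hd x).trans ?_
    gcongr
    refine (hc x).trans_eq (Finset.sum_congr rfl fun n hn => ?_)
    rw [Function.update_of_ne (Finset.mem_Ico.1 hn).2.ne]

/-- The `±1` transforms of real Haar polynomials satisfy an `L_p` bound up to a function of mean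
zero. -/
theorem exists_abs_rpow_le {p : ℝ} (hp : 2 ≤ p) (a ε : ℕ → ℝ) (hε : ∀ n, ε n = 1 ∨ ε n = -1)
    (N : ℕ) : ∃ c : ℕ → ℝ, ∀ x,
      |∑ n ∈ Finset.range N, ε n * a n * haarReal n x| ^ p ≤
        2 * (2 * p) ^ p * |∑ n ∈ Finset.range N, a n * haarReal n x| ^ p +
          ∑ n ∈ Finset.Ico 1 N, c n * haarReal n x := by
  obtain ⟨c, hc⟩ := exists_burkholder_le hp a ε hε N
  refine ⟨fun n => 2 * c n, fun x => ?_⟩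
  set F := ∑ n ∈ Finset.range N, a n * haarReal n x with hF
  set G := ∑ n ∈ Finset.range N, ε n * a n * haarReal n x with hG
  have hu : ∑ n ∈ Finset.range N, (1 + ε n) * a n * haarReal n x = F + G := by
    rw [hF, hG, ← Finset.sum_add_distrib]
    exact Finset.sum_congr rfl fun n _ => by ring
  have hv : ∑ n ∈ Finset.range N, (1 - ε n) * a n * haarReal n x = F - G := by
    rw [hF, hG, ← Finset.sum_sub_distrib]
    exact Finset.sum_congr rfl fun n _ => by ring
  have h1 := hc x
  rw [hu, hv] at h1
  have h2 := half_rpow_le_burkholder_add hp (F + G) (F - G)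
  have e1 : |F + G - (F - G)| / 2 = |G| := by
    rw [show F + G - (F - G) = 2 * G by ring, abs_mul, abs_two]
    ring
  have e2 : p ^ p * |F + G + (F - G)| ^ p = (2 * p) ^ p * |F| ^ p := by
    rw [show F + G + (F - G) = 2 * F by ring, abs_mul, abs_two,
      Real.mul_rpow two_pos.le (abs_nonneg F), Real.mul_rpow two_pos.le (by linarith)]
    ring
  rw [e1, e2] at h2
  have hs : ∑ n ∈ Finset.Ico 1 N, 2 * c n * haarReal n x =
      2 * ∑ n ∈ Finset.Ico 1 N, c n * haarReal n x := by
    rw [Finset.mul_sum]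
    exact Finset.sum_congr rfl fun n _ => by ring
  rw [hs]
  linarith

/-- The pointwise bound for complex coefficients, from the real and the imaginary part. -/
theorem exists_norm_rpow_le {p : ℝ} (hp : 2 ≤ p) (a : ℕ → ℂ) (ε : ℕ → ℝ)
    (hε : ∀ n, ε n = 1 ∨ ε n = -1) (N : ℕ) : ∃ c : ℕ → ℝ, ∀ x,
      ‖∑ n ∈ Finset.range N, (ε n * a n) * haar n x‖ ^ p ≤
        (16 * p) ^ p * ‖∑ n ∈ Finset.range N, a n * haar n x‖ ^ p +
          ∑ n ∈ Finset.Ico 1 N, c n * haarReal n x := by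
  obtain ⟨c, hc⟩ := exists_abs_rpow_le hp (fun n => (a n).re) ε hε N
  obtain ⟨d, hd⟩ := exists_abs_rpow_le hp (fun n => (a n).im) ε hε N
  refine ⟨fun n => 2 ^ p * (c n + d n), fun x => ?_⟩
  have hre : ∀ b : ℕ → ℂ, (∑ n ∈ Finset.range N, b n * haar n x).re =
      ∑ n ∈ Finset.range N, (b n).re * haarReal n x := fun b => by
    simp [← ofReal_haarReal]
  have him : ∀ b : ℕ → ℂ, (∑ n ∈ Finset.range N, b n * haar n x).im =
      ∑ n ∈ Finset.range N, (b n).im * haarReal n x := fun b => by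
    simp [← ofReal_haarReal]
  set F := ∑ n ∈ Finset.range N, a n * haar n x with hF
  set G := ∑ n ∈ Finset.range N, (ε n * a n) * haar n x with hG
  have hc' := hc x
  have hd' := hd x
  have e1 : G.re = ∑ n ∈ Finset.range N, ε n * (a n).re * haarReal n x := by
    rw [hG, hre]
    simp
  have e2 : G.im = ∑ n ∈ Finset.range N, ε n * (a n).im * haarReal n x := by
    rw [hG, him]
    simp
  rw [← e1, ← hre, ← hF] at hc'
  rw [← e2, ← him, ← hF] at hd'
  have hp0 : 0 ≤ p := by linarith
  have h1 : ‖G‖ ^ p ≤ 2 ^ p * (|G.re| ^ p + |G.im| ^ p) := by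
    have h2 : ‖G‖ ≤ 2 * max |G.re| |G.im| := by
      have := Complex.norm_le_abs_re_add_abs_im G
      have := le_max_left |G.re| |G.im|
      have := le_max_right |G.re| |G.im|
      linarith
    have h3 : 0 ≤ max |G.re| |G.im| := (abs_nonneg _).trans (le_max_left _ _)
    refine (Real.rpow_le_rpow (norm_nonneg _) h2 hp0).trans ?_
    rw [Real.mul_rpow two_pos.le h3]
    gcongr
    have h4 : 0 ≤ |G.re| ^ p := by positivity
    have h5 : 0 ≤ |G.im| ^ p := by positivity
    rcases max_choice |G.re| |G.im| with h | h <;> rw [h] <;> linarith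
  have h2 : |F.re| ^ p ≤ ‖F‖ ^ p :=
    Real.rpow_le_rpow (abs_nonneg _) (Complex.abs_re_le_norm F) hp0
  have h3 : |F.im| ^ p ≤ ‖F‖ ^ p :=
    Real.rpow_le_rpow (abs_nonneg _) (Complex.abs_im_le_norm F) hp0
  have h4 : (2 : ℝ) ^ p * (4 * (2 * p) ^ p) ≤ (16 * p) ^ p := by
    have h6 : (16 * p) ^ p = 4 ^ p * (2 ^ p * (2 * p) ^ p) := by
      rw [← Real.mul_rpow two_pos.le (by positivity), ← Real.mul_rpow (by norm_num) (by positivity)]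
      congr 1
      ring
    rw [h6]
    have : (4 : ℝ) ≤ 4 ^ p := by
      conv_lhs => rw [← Real.rpow_one 4]
      exact Real.rpow_le_rpow_of_exponent_le (by norm_num) (by linarith)
    have h5 : (0 : ℝ) ≤ 2 ^ p * (2 * p) ^ p := by positivity
    nlinarith
  have hsum : ∑ n ∈ Finset.Ico 1 N, 2 ^ p * (c n + d n) * haarReal n x =
      2 ^ p * (∑ n ∈ Finset.Ico 1 N, c n * haarReal n x +
        ∑ n ∈ Finset.Ico 1 N, d n * haarReal n x) := by
    rw [← Finset.sum_add_distrib, Finset.mul_sum]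
    exact Finset.sum_congr rfl fun n _ => by ring
  rw [hsum]
  calc ‖G‖ ^ p ≤ 2 ^ p * (|G.re| ^ p + |G.im| ^ p) := h1
    _ ≤ 2 ^ p * ((2 * (2 * p) ^ p * ‖F‖ ^ p + ∑ n ∈ Finset.Ico 1 N, c n * haarReal n x) +
        (2 * (2 * p) ^ p * ‖F‖ ^ p + ∑ n ∈ Finset.Ico 1 N, d n * haarReal n x)) := by
        gcongr
        · refine hc'.trans ?_
          gcongr
        · refine hd'.trans ?_
          gcongr
    _ = 2 ^ p * (4 * (2 * p) ^ p) * ‖F‖ ^ p + 2 ^ p *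
        (∑ n ∈ Finset.Ico 1 N, c n * haarReal n x + ∑ n ∈ Finset.Ico 1 N, d n * haarReal n x) := by
        ring
    _ ≤ _ := by gcongr

/-! ### The Haar system in `L_p` -/

section Lp

variable (p : ℝ≥0∞)

/-- The Haar functions as elements of `L_p([0,1])`, without normalization. -/
noncomputable def haarLp (n : ℕ) : LpUnit p := (memLp_haar p n).toLp (haar n)

variable {p} in
theorem memLp_sum_const_mul {u : ℕ → ℝ → ℂ} (hu : ∀ n, MemLp (u n) p unitVolume) (s : Finset ℕ)
    (b : ℕ → ℂ) : MemLp (fun x => ∑ n ∈ s, b n * u n x) p unitVolume :=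
  memLp_finsetSum s fun n _ => (hu n).const_mul (b n)

variable {p} in
theorem sum_smul_toLp {u : ℕ → ℝ → ℂ} (hu : ∀ n, MemLp (u n) p unitVolume) (s : Finset ℕ)
    (b : ℕ → ℂ) :
    ∑ n ∈ s, b n • (hu n).toLp (u n) = (memLp_sum_const_mul hu s b).toLp _ := by
  induction s using Finset.induction_on with
  | empty => simp only [Finset.sum_empty]; exact (MemLp.toLp_zero _).symm
  | insert n s hn ih =>
    rw [Finset.sum_insert hn, ih, ← MemLp.toLp_const_smul, ← MemLp.toLp_add]
    refine (MemLp.toLp_eq_toLp_iff _ _).2 (Eventually.of_forall fun x => ?_)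
    simp [Finset.sum_insert hn]

theorem memLp_sum_haar (s : Finset ℕ) (b : ℕ → ℂ) :
    MemLp (fun x => ∑ n ∈ s, b n * haar n x) p unitVolume :=
  memLp_sum_const_mul (memLp_haar p) s b

theorem sum_smul_haarLp (s : Finset ℕ) (b : ℕ → ℂ) :
    ∑ n ∈ s, b n • haarLp p n = (memLp_sum_haar p s b).toLp _ :=
  sum_smul_toLp (memLp_haar p) s b

variable {p}

theorem normalizedHaar_eq (n : ℕ) :
    normalizedHaar p n = ((‖haarLp p n‖⁻¹ : ℝ) : ℂ) • haarLp p n := rfl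

/-- The indicator of a dyadic interval is a Haar polynomial: the indicators of the two halves of an
interval are half the sum and half the difference of its indicator and its Haar function. -/
theorem toLp_indicator_dyadic_mem_span (k a : ℕ) (ha : a < 2 ^ k) :
    (((memLp_const (1 : ℂ)).indicator (measurableSet_dyadic k a) :
      MemLp ((dyadic k a).indicator fun _ => (1 : ℂ)) p unitVolume).toLp _ : LpUnit p) ∈
      Submodule.span ℂ (range (haarLp p)) := by
  induction k generalizing a with
  | zero =>
    obtain rfl : a = 0 := by simpa using ha
    have hmem : haarLp p 0 ∈ Submodule.span ℂ (range (haarLp p)) :=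
      Submodule.subset_span (mem_range_self 0)
    convert hmem using 1
    refine (MemLp.toLp_eq_toLp_iff _ _).2 ?_
    have h1 : ∀ᵐ x ∂unitVolume, x ∈ Icc (0 : ℝ) 1 := ae_restrict_mem measurableSet_Icc
    have h2 : ∀ᵐ x ∂unitVolume, x ≠ 1 := ae_restrict_of_ae (Measure.ae_ne volume 1)
    filter_upwards [h1, h2] with x hx hx1
    rw [haar_zero_apply, indicator_of_mem]
    simpa [dyadic] using ⟨hx.1, hx.2.lt_of_ne hx1⟩
  | succ k ih =>
    obtain ⟨c, hc, hac⟩ : ∃ c < 2 ^ k, a = 2 * c ∨ a = 2 * c + 1 :=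
      ⟨a / 2, by rw [pow_succ] at ha; omega, by omega⟩
    -- The Haar function with index `2 ^ k + c` is supported on the interval of level `k` that
    -- contains the given one.
    have hlog : Nat.log 2 (2 ^ k + c) = k := by
      rw [Nat.log_eq_iff (Or.inr ⟨one_lt_two, by positivity⟩), pow_succ]
      omega
    have hpos : haarPos (2 ^ k + c) = c := by rw [haarPos, hlog, Nat.add_sub_cancel_left]
    have hne : 2 ^ k + c ≠ 0 := by positivity
    have hmem1 := ih c hc
    have hmem2 : haarLp p (2 ^ k + c) ∈ Submodule.span ℂ (range (haarLp p)) :=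
      Submodule.subset_span (mem_range_self _)
    have hsplit : ∀ x, (dyadic k c).indicator (fun _ => (1 : ℂ)) x =
        (dyadic (k + 1) (2 * c)).indicator (fun _ => (1 : ℂ)) x +
          (dyadic (k + 1) (2 * c + 1)).indicator (fun _ => (1 : ℂ)) x := fun x => by
      by_cases h1 : x ∈ dyadic (k + 1) (2 * c) <;>
        by_cases h2 : x ∈ dyadic (k + 1) (2 * c + 1) <;>
        simp [mem_dyadic_iff_succ (k := k), h1, h2]
      have := eq_of_mem_dyadic h1 h2
      omega
    have hhaar : ∀ x, haar (2 ^ k + c) x =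
        (dyadic (k + 1) (2 * c)).indicator (fun _ => (1 : ℂ)) x -
          (dyadic (k + 1) (2 * c + 1)).indicator (fun _ => (1 : ℂ)) x := fun x => by
      rw [haar_apply hne, hlog, hpos]
      by_cases h1 : x ∈ dyadic (k + 1) (2 * c) <;>
        by_cases h2 : x ∈ dyadic (k + 1) (2 * c + 1) <;> simp [h1, h2]
      have := eq_of_mem_dyadic h1 h2
      omega
    rcases hac with rfl | rfl
    · convert Submodule.smul_mem _ (2⁻¹ : ℂ) (Submodule.add_mem _ hmem1 hmem2) using 1
      rw [haarLp, ← MemLp.toLp_add, ← MemLp.toLp_const_smul]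
      refine (MemLp.toLp_eq_toLp_iff _ _).2 (Eventually.of_forall fun x => ?_)
      rw [Pi.smul_apply, Pi.add_apply, hsplit, hhaar, smul_eq_mul]
      ring
    · convert Submodule.smul_mem _ (2⁻¹ : ℂ) (Submodule.sub_mem _ hmem1 hmem2) using 1
      rw [haarLp, ← MemLp.toLp_sub, ← MemLp.toLp_const_smul]
      refine (MemLp.toLp_eq_toLp_iff _ _).2 (Eventually.of_forall fun x => ?_)
      rw [Pi.smul_apply, Pi.sub_apply, hsplit, hhaar, smul_eq_mul]
      ring

variable [Fact (1 ≤ p)]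

theorem exponent_ne_zero : p ≠ 0 := ((zero_lt_one' ℝ≥0∞).trans_le Fact.out).ne'

theorem norm_toLp_rpow {f : ℝ → ℂ} (hf : MemLp f p unitVolume) (hp : p ≠ ∞) :
    ‖hf.toLp f‖ ^ p.toReal = ∫ x, ‖f x‖ ^ p.toReal ∂unitVolume := by
  have hpos : 0 < p.toReal := ENNReal.toReal_pos exponent_ne_zero hp
  have hint : 0 ≤ ∫ x, ‖f x‖ ^ p.toReal ∂unitVolume := integral_nonneg fun x => by positivity
  rw [Lp.norm_toLp, hf.eLpNorm_eq_integral_rpow_norm exponent_ne_zero hp,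
    ENNReal.toReal_ofReal (by positivity), ← Real.rpow_mul hint, inv_mul_cancel₀ hpos.ne',
    Real.rpow_one]

theorem norm_sum_smul_haarLp_rpow (hp : p ≠ ∞) (s : Finset ℕ) (b : ℕ → ℂ) :
    ‖∑ n ∈ s, b n • haarLp p n‖ ^ p.toReal =
      ∫ x, ‖∑ n ∈ s, b n * haar n x‖ ^ p.toReal ∂unitVolume := by
  rw [sum_smul_haarLp, norm_toLp_rpow _ hp]

theorem norm_haarLp_rpow (hp : p ≠ ∞) (n : ℕ) :
    ‖haarLp p n‖ ^ p.toReal = (2 ^ Nat.log 2 n)⁻¹ := by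
  have hpos : 0 < p.toReal := ENNReal.toReal_pos exponent_ne_zero hp
  rw [haarLp, norm_toLp_rpow _ hp, ← integral_haarReal_mul_self]
  congr 1
  funext x
  rw [← ofReal_haarReal, Complex.norm_real, Real.norm_eq_abs]
  rcases eq_or_ne n 0 with rfl | hn
  · simp [haarReal_zero_apply]
  by_cases hx : x ∈ haarSupport n
  · rcases haarReal_of_mem hn hx with h | h <;> simp [h]
  · simp [haarReal_of_notMem hn hx, hpos.ne']

theorem norm_haarLp_pos (hp : p ≠ ∞) (n : ℕ) : 0 < ‖haarLp p n‖ := by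
  refine (norm_nonneg (haarLp p n)).lt_of_ne' fun h => ?_
  have := norm_haarLp_rpow hp n
  rw [h, Real.zero_rpow (ENNReal.toReal_pos exponent_ne_zero hp).ne'] at this
  have h2 : (0 : ℝ) < (2 ^ Nat.log 2 n)⁻¹ := by positivity
  linarith

theorem norm_normalizedHaar (hp : p ≠ ∞) (n : ℕ) : ‖normalizedHaar p n‖ = 1 := by
  rw [normalizedHaar_eq, norm_smul, Complex.norm_real, norm_inv, norm_norm,
    inv_mul_cancel₀ (norm_haarLp_pos hp n).ne']

/-- The `±1` multipliers of the Haar system are bounded on Haar polynomials in `L_p`. -/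
theorem norm_sum_sign_smul_haarLp_le (hp2 : 2 ≤ p) (hp : p ≠ ∞) (a : ℕ → ℂ) (ε : ℕ → ℝ)
    (hε : ∀ n, ε n = 1 ∨ ε n = -1) (N : ℕ) :
    ‖∑ n ∈ Finset.range N, ((ε n : ℂ) * a n) • haarLp p n‖ ≤
      16 * p.toReal * ‖∑ n ∈ Finset.range N, a n • haarLp p n‖ := by
  have hr : 2 ≤ p.toReal := by
    simpa using (ENNReal.toReal_le_toReal (by simp) hp).2 hp2
  obtain ⟨c, hc⟩ := exists_norm_rpow_le hr a ε hε N
  have hi : ∀ b : ℕ → ℂ, Integrable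
      (fun x => ‖∑ n ∈ Finset.range N, b n * haar n x‖ ^ p.toReal) unitVolume := fun b =>
    (memLp_sum_haar p _ b).integrable_norm_rpow exponent_ne_zero hp
  have hi' : ∀ n ∈ Finset.Ico 1 N, Integrable (fun x => c n * haarReal n x) unitVolume :=
    fun n _ => (integrable_haarReal n).const_mul _
  have hzero : ∫ x, ∑ n ∈ Finset.Ico 1 N, c n * haarReal n x ∂unitVolume = 0 := by
    rw [integral_finsetSum _ hi']
    refine Finset.sum_eq_zero fun n hn => ?_
    rw [integral_const_mul, integral_haarReal (Nat.one_le_iff_ne_zero.1 (Finset.mem_Ico.1 hn).1),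
      mul_zero]
  have h1 := integral_mono (hi _)
    (((hi a).const_mul ((16 * p.toReal) ^ p.toReal)).add (integrable_finsetSum _ hi')) hc
  rw [integral_add' ((hi a).const_mul _) (integrable_finsetSum _ hi'), integral_const_mul,
    hzero, add_zero, ← norm_sum_smul_haarLp_rpow hp,
    ← norm_sum_smul_haarLp_rpow hp] at h1
  refine (Real.rpow_le_rpow_iff (norm_nonneg _) (by positivity)
    (by linarith : 0 < p.toReal)).1 ?_
  rwa [Real.mul_rpow (by positivity) (norm_nonneg _)]

/-- Unconditionality of the Haar system: partial sums over arbitrary sets of indices are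
controlled. -/
theorem norm_sum_subset_smul_haarLp_le (hp2 : 2 ≤ p) (hp : p ≠ ∞) (a : ℕ → ℂ)
    {S : Finset ℕ} {N : ℕ} (hS : S ⊆ Finset.range N) :
    ‖∑ n ∈ S, a n • haarLp p n‖ ≤
      (16 * p.toReal + 1) * ‖∑ n ∈ Finset.range N, a n • haarLp p n‖ := by
  have h := norm_sum_sign_smul_haarLp_le hp2 hp a (fun n => if n ∈ S then 1 else -1)
    (fun n => by by_cases hn : n ∈ S <;> simp [hn]) N
  have h2 : (2 : ℂ) • ∑ n ∈ S, a n • haarLp p n = ∑ n ∈ Finset.range N, a n • haarLp p n +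
      ∑ n ∈ Finset.range N, (((if n ∈ S then 1 else -1 : ℝ) : ℂ) * a n) • haarLp p n := by
    rw [← Finset.sum_add_distrib, Finset.smul_sum, ← Finset.sum_subset hS]
    · refine Finset.sum_congr rfl fun n hn => ?_
      simp [hn, two_smul]
    · intro n _ hn
      simp [hn]
  have h3 : 2 * ‖∑ n ∈ S, a n • haarLp p n‖ ≤ ‖∑ n ∈ Finset.range N, a n • haarLp p n‖ +
      16 * p.toReal * ‖∑ n ∈ Finset.range N, a n • haarLp p n‖ := by
    calc 2 * ‖∑ n ∈ S, a n • haarLp p n‖ = ‖(2 : ℂ) • ∑ n ∈ S, a n • haarLp p n‖ := by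
          rw [norm_smul, Complex.norm_ofNat]
      _ ≤ _ := by
          rw [h2]
          exact (norm_add_le _ _).trans (by gcongr)
  have h4 := norm_nonneg (∑ n ∈ S, a n • haarLp p n)
  linarith

theorem norm_haar_le (n : ℕ) (x : ℝ) : ‖haar n x‖ ≤ 1 := by
  rcases eq_or_ne n 0 with rfl | hn
  · simp [haar_zero_apply]
  · rw [haar_apply hn]
    split_ifs <;> simp

theorem integrable_haar_mul (n : ℕ) (f : LpUnit p) :
    Integrable (fun x => haar n x * f x) unitVolume :=
  ((Lp.memLp f).integrable Fact.out).bdd_mul (memLp_haar 1 n).1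
    (Eventually.of_forall (norm_haar_le n))

variable (p)

/-- The functional `f ↦ ∫ h_n f` on `L_p([0,1])`. -/
noncomputable def haarCoord (n : ℕ) : StrongDual ℂ (LpUnit p) :=
  LinearMap.mkContinuous
    { toFun := fun f => ∫ x, haar n x * f x ∂unitVolume
      map_add' := fun f g => by
        rw [← integral_add (integrable_haar_mul n f) (integrable_haar_mul n g)]
        refine integral_congr_ae ?_
        filter_upwards [Lp.coeFn_add f g] with x hx
        rw [hx, Pi.add_apply, mul_add]
      map_smul' := fun c f => by
        rw [RingHom.id_apply, smul_eq_mul, ← integral_const_mul]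
        refine integral_congr_ae ?_
        filter_upwards [Lp.coeFn_smul c f] with x hx
        rw [hx, Pi.smul_apply, smul_eq_mul, mul_left_comm] }
    1 fun f => by
      have hf : MemLp f p unitVolume := Lp.memLp f
      have h1 : ‖∫ x, haar n x * f x ∂unitVolume‖ ≤ ∫ x, ‖f x‖ ∂unitVolume := by
        refine norm_integral_le_of_norm_le (hf.integrable Fact.out).norm
          (Eventually.of_forall fun x => ?_)
        rw [norm_mul]
        exact mul_le_of_le_one_left (norm_nonneg _) (norm_haar_le n x)
      have h2 : ∫ x, ‖f x‖ ∂unitVolume ≤ ‖f‖ := by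
        rw [integral_norm_eq_lintegral_enorm hf.1, ← eLpNorm_one_eq_lintegral_enorm, Lp.norm_def]
        exact ENNReal.toReal_mono hf.2.ne
          (eLpNorm_le_eLpNorm_of_exponent_le Fact.out hf.1)
      rw [one_mul]
      exact h1.trans h2

theorem haarCoord_haarLp (m n : ℕ) :
    haarCoord p m (haarLp p n) = if m = n then (((2 ^ Nat.log 2 n)⁻¹ : ℝ) : ℂ) else 0 := by
  have h : haarCoord p m (haarLp p n) =
      ∫ x, ((haarReal m x * haarReal n x : ℝ) : ℂ) ∂unitVolume := by
    refine integral_congr_ae ?_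
    filter_upwards [(memLp_haar p n).coeFn_toLp] with x hx
    rw [haarLp, hx, Complex.ofReal_mul, ofReal_haarReal, ofReal_haarReal]
  rw [h, integral_complex_ofReal, integral_haarReal_mul]
  split_ifs <;> simp

/-- The coordinate functionals of the normalized Haar system. -/
noncomputable def normalizedHaarCoord (n : ℕ) : StrongDual ℂ (LpUnit p) :=
  ((‖haarLp p n‖ * 2 ^ Nat.log 2 n : ℝ) : ℂ) • haarCoord p n

variable {p}

theorem normalizedHaarCoord_normalizedHaar (hp : p ≠ ∞) (m n : ℕ) :
    normalizedHaarCoord p m (normalizedHaar p n) = if m = n then 1 else 0 := by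
  rw [normalizedHaar_eq, map_smul, normalizedHaarCoord, smul_apply, haarCoord_haarLp]
  split_ifs with h
  · rw [h, smul_eq_mul, smul_eq_mul, ← Complex.ofReal_mul, ← Complex.ofReal_mul]
    have := (norm_haarLp_pos hp n).ne'
    rw [show ‖haarLp p n‖⁻¹ * (‖haarLp p n‖ * 2 ^ Nat.log 2 n * (2 ^ Nat.log 2 n)⁻¹) = 1 by
      field_simp]
    simp
  · simp

/-! ### Density of the span of the Haar system -/

/-- Continuous functions are uniformly approximated by dyadic step functions. -/
theorem dense_span_haarLp (hp : p ≠ ∞) :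
    Dense (Submodule.span ℂ (range (haarLp p)) : Set (LpUnit p)) := by
  have hsub : range (BoundedContinuousFunction.toLp (E := ℂ) p unitVolume ℂ) ⊆
      closure (Submodule.span ℂ (range (haarLp p)) : Set (LpUnit p)) := by
    rintro _ ⟨g, rfl⟩
    rw [Metric.mem_closure_iff]
    intro δ hδ
    obtain ⟨η, hη, hg⟩ := Metric.uniformContinuousOn_iff.1
      (isCompact_Icc.uniformContinuousOn_of_continuous
        (g.continuous.continuousOn (s := Icc (0 : ℝ) 1))) (δ / 2) (by positivity)
    obtain ⟨k, hk⟩ := exists_pow_lt_of_lt_one hη (show (2⁻¹ : ℝ) < 1 by norm_num)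
    set b : ℕ → ℝ → ℂ := fun a => (dyadic k a).indicator fun _ => (1 : ℂ) with hb
    have hbm : ∀ a, MemLp (b a) p unitVolume := fun a =>
      (memLp_const (1 : ℂ)).indicator (measurableSet_dyadic k a)
    refine ⟨∑ a ∈ Finset.range (2 ^ k), g (a / 2 ^ k) • (hbm a).toLp (b a),
      Submodule.sum_mem _ fun a ha =>
        Submodule.smul_mem _ _ (toLp_indicator_dyadic_mem_span k a (Finset.mem_range.1 ha)), ?_⟩
    rw [dist_eq_norm]
    refine lt_of_le_of_lt ?_ (half_lt_self hδ)
    have hae : ∀ᵐ x ∂unitVolume, ‖(BoundedContinuousFunction.toLp (E := ℂ) p unitVolume ℂ g -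
        ∑ a ∈ Finset.range (2 ^ k), g (a / 2 ^ k) • (hbm a).toLp (b a) : LpUnit p) x‖ ≤
        δ / 2 := by
      have h1 : ∀ᵐ x ∂unitVolume, x ∈ Icc (0 : ℝ) 1 := ae_restrict_mem measurableSet_Icc
      have h2 : ∀ᵐ x ∂unitVolume, x ≠ 1 := ae_restrict_of_ae (Measure.ae_ne volume 1)
      have h3 := Lp.coeFn_sub (BoundedContinuousFunction.toLp (E := ℂ) p unitVolume ℂ g)
        (∑ a ∈ Finset.range (2 ^ k), g (a / 2 ^ k) • (hbm a).toLp (b a))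
      have h4 := BoundedContinuousFunction.coeFn_toLp (p := p) unitVolume ℂ g
      have h5 : ((∑ a ∈ Finset.range (2 ^ k), g (a / 2 ^ k) • (hbm a).toLp (b a) : LpUnit p) :
          ℝ → ℂ) =ᵐ[unitVolume] fun x => ∑ a ∈ Finset.range (2 ^ k), g (a / 2 ^ k) * b a x := by
        rw [sum_smul_toLp]
        exact MemLp.coeFn_toLp _
      filter_upwards [h1, h2, h3, h4, h5] with x hx hx1 hx3 hx4 hx5
      rw [hx3, Pi.sub_apply, hx4, hx5]
      have hx0 : (0 : ℝ) ≤ 2 ^ k * x := mul_nonneg (by positivity) hx.1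
      -- The dyadic interval containing `x`.
      set c : ℕ := ⌊(2 : ℝ) ^ k * x⌋₊ with hc
      have hxc : x ∈ dyadic k c := by
        rw [mem_dyadic, hc]
        exact (Int.natCast_floor_eq_floor hx0).symm
      have hclt : c < 2 ^ k := by
        rw [hc, Nat.floor_lt hx0]
        push_cast
        have : x < 1 := hx.2.lt_of_ne hx1
        nlinarith [show (0 : ℝ) < 2 ^ k by positivity]
      rw [Finset.sum_eq_single_of_mem c (Finset.mem_range.2 hclt)]
      · rw [hb]
        simp only [indicator_of_mem hxc, mul_one]
        rw [← dist_eq_norm]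
        refine (hg x hx _ ⟨by positivity, ?_⟩ ?_).le
        · rw [div_le_one (by positivity)]
          exact_mod_cast hclt.le
        · rw [Real.dist_eq, abs_of_nonneg (sub_nonneg.2 hxc.1)]
          have := hxc.2
          rw [add_div, one_div, ← inv_pow] at this
          linarith
      · intro a _ hac
        rw [hb]
        simp only [indicator_of_notMem fun h => hac (eq_of_mem_dyadic h hxc), mul_zero]
    refine (Lp.norm_le_of_ae_bound (by positivity) hae).trans_eq ?_
    simp [measureUnivNNReal]
  have h := BoundedContinuousFunction.toLp_denseRange (E := ℂ) (p := p) unitVolume ℂ hp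
  exact dense_closure.1 (h.mono hsub)

end Lp

/-! ### Rearrangements of the Haar basis -/

section Rearranged

variable {p : ℝ≥0∞} [Fact (1 ≤ p)]

theorem haarLp_eq_smul_normalizedHaar (hp : p ≠ ∞) (n : ℕ) :
    haarLp p n = (‖haarLp p n‖ : ℂ) • normalizedHaar p n := by
  rw [normalizedHaar_eq, smul_smul, ← Complex.ofReal_mul,
    mul_inv_cancel₀ (norm_haarLp_pos hp n).ne', Complex.ofReal_one, one_smul]

theorem eventually_sum_normalizedHaarCoord_eq (hp : p ≠ ∞) {f : LpUnit p}
    (hf : f ∈ Submodule.span ℂ (range (haarLp p))) : ∀ᶠ N in atTop,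
      ∑ n ∈ Finset.range N, normalizedHaarCoord p n f • normalizedHaar p n = f := by
  induction hf using Submodule.span_induction with
  | mem f hf =>
    obtain ⟨j, rfl⟩ := hf
    filter_upwards [eventually_gt_atTop j] with N hN
    rw [haarLp_eq_smul_normalizedHaar hp j]
    simp [normalizedHaarCoord_normalizedHaar hp, hN]
  | zero => simp
  | add f g _ _ hf hg =>
    filter_upwards [hf, hg] with N hf hg
    simp only [map_add, add_smul, Finset.sum_add_distrib, hf, hg]
  | smul c f _ hf =>
    filter_upwards [hf] with N hf
    simp only [map_smul, smul_assoc, ← Finset.smul_sum, hf]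

/-- The partial sum operators of a rearranged Haar system are uniformly bounded. -/
theorem norm_sum_smulRight_normalizedHaar_le (hp2 : 2 ≤ p) (hp : p ≠ ∞) (σ : Equiv.Perm ℕ)
    (N : ℕ) : ‖∑ i ∈ Finset.range N, (normalizedHaarCoord p (σ i)).smulRight
      (normalizedHaar p (σ i))‖ ≤ 16 * p.toReal + 1 := by
  refine ContinuousLinearMap.opNorm_le_bound _ (by positivity) fun f => ?_
  set P := ∑ i ∈ Finset.range N, (normalizedHaarCoord p (σ i)).smulRight
      (normalizedHaar p (σ i)) with hP
  have hclosed : IsClosed {f : LpUnit p | ‖P f‖ ≤ (16 * p.toReal + 1) * ‖f‖} :=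
    isClosed_le (by fun_prop) (by fun_prop)
  have hsub : (Submodule.span ℂ (range (haarLp p)) : Set (LpUnit p)) ⊆
      {f : LpUnit p | ‖P f‖ ≤ (16 * p.toReal + 1) * ‖f‖} := by
    intro f hf
    set S := (Finset.range N).map σ.toEmbedding with hS
    obtain ⟨M, hM, hSM⟩ := ((eventually_sum_normalizedHaarCoord_eq hp hf).and
      (eventually_ge_atTop (S.sup id + 1))).exists
    have hsubset : S ⊆ Finset.range M := fun n hn => by
      have : n ≤ S.sup id := Finset.le_sup (f := id) hn
      exact Finset.mem_range.2 (by omega)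
    have h := norm_sum_subset_smul_haarLp_le hp2 hp
      (fun n => normalizedHaarCoord p n f * ((‖haarLp p n‖⁻¹ : ℝ) : ℂ)) hsubset
    simp only [mul_smul, ← normalizedHaar_eq] at h
    rw [hM] at h
    have hPf : P f = ∑ n ∈ S, normalizedHaarCoord p n f • normalizedHaar p n := by
      rw [hS, Finset.sum_map, hP]
      simp [sum_apply]
    rw [mem_ofPred_eq, hPf]
    exact h
  have := closure_minimal hsub hclosed
  rw [(dense_span_haarLp hp).closure_eq] at this
  exact this (mem_univ f)

theorem dense_span_normalizedHaar_comp (hp : p ≠ ∞) (σ : Equiv.Perm ℕ) :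
    Dense (Submodule.span ℂ (range fun m => normalizedHaar p (σ m)) : Set (LpUnit p)) := by
  refine (dense_span_haarLp hp).mono (Submodule.span_le.2 ?_)
  rintro _ ⟨n, rfl⟩
  rw [SetLike.mem_coe, haarLp_eq_smul_normalizedHaar hp]
  refine Submodule.smul_mem _ _ (Submodule.subset_span ⟨σ.symm n, ?_⟩)
  simp only [Equiv.apply_symm_apply]

/-- Every rearrangement of the normalized Haar system is a Schauder basis of `L_p([0,1])`. -/
noncomputable def haarBasis (hp2 : 2 ≤ p) (hp : p ≠ ∞) (σ : Equiv.Perm ℕ) :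
    SchauderBasis ℂ (LpUnit p) :=
  schauderBasisOfBounded (fun m => normalizedHaar p (σ m)) (fun m => normalizedHaarCoord p (σ m))
    (fun i j => by simp [normalizedHaarCoord_normalizedHaar hp])
    (norm_sum_smulRight_normalizedHaar_le hp2 hp σ) (dense_span_normalizedHaar_comp hp σ)

theorem haarBasis_apply (hp2 : 2 ≤ p) (hp : p ≠ ∞) (σ : Equiv.Perm ℕ) (m : ℕ) :
    haarBasis hp2 hp σ m = normalizedHaar p (σ m) := rfl

end Rearranged

/-! ### Disjoint Haar functions and the comparison with `L_2` -/

/-- By orthogonality in `L_2`, the `L_p` norm of a Haar polynomial is at least the `ℓ_2` norm of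
its coefficients relative to the `L_2`-normalized system. -/
theorem sum_sq_le_norm_sum_smul_haarLp_sq {p : ℝ≥0∞} (hp2 : 2 ≤ p) {n : ℕ → ℕ}
    (hn : Function.Injective n) (s : Finset ℕ) (ρ : ℕ → ℝ) : ∑ k ∈ s, ρ k ^ 2 * (2 ^ Nat.log 2 (n k))⁻¹ ≤
      ‖∑ k ∈ s, (ρ k : ℂ) • haarLp p (n k)‖ ^ 2 := by
  have hmem : ∀ q : ℝ≥0∞, MemLp (fun x => ∑ k ∈ s, (ρ k : ℂ) * haar (n k) x) q unitVolume :=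
    fun q => memLp_sum_const_mul (u := fun k => haar (n k)) (fun k => memLp_haar q (n k)) s _
  have h1 : ∑ k ∈ s, (ρ k : ℂ) • haarLp p (n k) = (hmem p).toLp _ :=
    sum_smul_toLp (u := fun k => haar (n k)) (fun k => memLp_haar p (n k)) s _
  have h2 : ‖(hmem 2).toLp _‖ ≤ ‖(hmem p).toLp _‖ := by
    rw [Lp.norm_toLp, Lp.norm_toLp]
    exact ENNReal.toReal_mono (hmem p).2.ne
      (eLpNorm_le_eLpNorm_of_exponent_le hp2 (hmem p).1)
  have h3 : ‖(hmem 2).toLp _‖ ^ 2 = ∑ k ∈ s, ρ k ^ 2 * (2 ^ Nat.log 2 (n k))⁻¹ := by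
    have h4 := norm_toLp_rpow (hmem 2) (by simp)
    simp only [ENNReal.toReal_ofNat, Real.rpow_two] at h4
    have h5 : ∀ x, ‖∑ k ∈ s, (ρ k : ℂ) * haar (n k) x‖ ^ 2 =
        ∑ k ∈ s, ∑ l ∈ s, ρ k * ρ l * (haarReal (n k) x * haarReal (n l) x) := fun x => by
      have : ∑ k ∈ s, (ρ k : ℂ) * haar (n k) x =
          ((∑ k ∈ s, ρ k * haarReal (n k) x : ℝ) : ℂ) := by
        push_cast
        simp only [ofReal_haarReal]
      rw [this, Complex.norm_real, Real.norm_eq_abs, sq_abs, sq, Finset.sum_mul_sum]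
      exact Finset.sum_congr rfl fun k _ => Finset.sum_congr rfl fun l _ => by ring
    have hint : ∀ k l, Integrable (fun x => ρ k * ρ l * (haarReal (n k) x * haarReal (n l) x))
        unitVolume := fun k l =>
      ((memLp_haarReal 2 (n k)).integrable_mul (memLp_haarReal 2 (n l))).const_mul _
    rw [h4]
    simp only [h5]
    rw [integral_finsetSum _ fun k _ => integrable_finsetSum _ fun l _ => hint k l]
    refine Finset.sum_congr rfl fun k hk => ?_
    rw [integral_finsetSum _ fun l _ => hint k l]
    simp only [integral_const_mul, integral_haarReal_mul, hn.eq_iff]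
    simp [hk, sq]
  rw [h1, ← h3]
  gcongr

section Estimates

variable {p : ℝ≥0∞} [Fact (1 ≤ p)]

/-- Normalized Haar functions with disjoint supports span `ℓ_p` isometrically. -/
theorem norm_sum_smul_normalizedHaar_of_disjoint (hp : p ≠ ∞) {d : ℕ → ℕ} (hd : ∀ k, d k ≠ 0)
    (hdisj : ∀ k l, k ≠ l → Disjoint (haarSupport (d k)) (haarSupport (d l))) (s : Finset ℕ)
    (c : ℕ → ℂ) : ‖∑ k ∈ s, c k • normalizedHaar p (d k)‖ ^ p.toReal =
      ∑ k ∈ s, ‖c k‖ ^ p.toReal := by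
  have hpos : 0 < p.toReal := ENNReal.toReal_pos exponent_ne_zero hp
  set b : ℕ → ℂ := fun k => c k * ((‖haarLp p (d k)‖⁻¹ : ℝ) : ℂ) with hb
  have h1 : ∑ k ∈ s, c k • normalizedHaar p (d k) = ∑ k ∈ s, b k • haarLp p (d k) := by
    simp only [normalizedHaar_eq, hb, mul_smul]
  have hpt : ∀ x, ‖∑ k ∈ s, b k * haar (d k) x‖ ^ p.toReal =
      ∑ k ∈ s, ‖b k‖ ^ p.toReal * ‖haar (d k) x‖ ^ p.toReal := by
    intro x
    have hzero : ∀ k l, k ≠ l → x ∈ haarSupport (d k) → haar (d l) x = 0 := fun k l hkl hx => by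
      rw [← ofReal_haarReal, haarReal_of_notMem (hd l) (disjoint_left.1 (hdisj k l hkl) hx),
        Complex.ofReal_zero]
    by_cases hx : ∃ k ∈ s, x ∈ haarSupport (d k)
    · obtain ⟨k, hk, hx⟩ := hx
      rw [Finset.sum_eq_single_of_mem k hk, Finset.sum_eq_single_of_mem k hk, norm_mul,
        Real.mul_rpow (norm_nonneg _) (norm_nonneg _)]
      · intro l _ hl
        rw [hzero k l hl.symm hx, norm_zero, Real.zero_rpow hpos.ne', mul_zero]
      · intro l _ hl
        rw [hzero k l hl.symm hx, mul_zero]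
    · have hz : ∀ k ∈ s, haar (d k) x = 0 := fun k hk => by
        rw [← ofReal_haarReal, haarReal_of_notMem (hd k) fun h => hx ⟨k, hk, h⟩,
          Complex.ofReal_zero]
      rw [Finset.sum_eq_zero fun k hk => by rw [hz k hk, mul_zero],
        Finset.sum_eq_zero fun k hk => by
          rw [hz k hk, norm_zero, Real.zero_rpow hpos.ne', mul_zero],
        norm_zero, Real.zero_rpow hpos.ne']
  have hint : ∀ k, ∫ x, ‖haar (d k) x‖ ^ p.toReal ∂unitVolume = ‖haarLp p (d k)‖ ^ p.toReal :=
    fun k => (norm_toLp_rpow (memLp_haar p (d k)) hp).symm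
  rw [h1]
  simp only [haarLp]
  rw [sum_smul_toLp (u := fun k => haar (d k)) (fun k => memLp_haar p (d k)),
    norm_toLp_rpow _ hp]
  simp only [hpt]
  rw [integral_finsetSum _ fun k _ => ((memLp_haar p (d k)).integrable_norm_rpow
    exponent_ne_zero hp).const_mul _]
  refine Finset.sum_congr rfl fun k _ => ?_
  rw [integral_const_mul, hint, ← Real.mul_rpow (norm_nonneg _) (norm_nonneg _), hb]
  simp only [norm_mul, Complex.norm_real, norm_inv, norm_norm]
  rw [inv_mul_cancel_right₀ (norm_haarLp_pos hp (d k)).ne']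

end Estimates

/-! ### The permutation -/

/-- The involution of `ℕ` which swaps `4 * i + 3` with `2 ^ (i + 2) + 1` for all `i`. -/
def haarSwap (m : ℕ) : ℕ :=
  if m % 4 = 3 then 2 ^ (m / 4 + 2) + 1 else
    if m = 2 ^ Nat.log 2 m + 1 ∧ 5 ≤ m then 4 * (Nat.log 2 m - 2) + 3 else m

theorem log_two_pow_add_one (i : ℕ) : Nat.log 2 (2 ^ (i + 2) + 1) = i + 2 := by
  have := Nat.two_pow_pos i
  have h1 : 2 ^ (i + 2) = 4 * 2 ^ i := by ring
  have h2 : 2 ^ (i + 2 + 1) = 8 * 2 ^ i := by ring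
  rw [Nat.log_eq_iff (Or.inr ⟨one_lt_two, by positivity⟩)]
  omega

theorem haarSwap_four_mul_add_three (i : ℕ) : haarSwap (4 * i + 3) = 2 ^ (i + 2) + 1 := by
  rw [haarSwap, if_pos (by omega), show (4 * i + 3) / 4 = i by omega]

theorem haarSwap_two_pow_add_one (i : ℕ) : haarSwap (2 ^ (i + 2) + 1) = 4 * i + 3 := by
  have := Nat.two_pow_pos i
  have h : (2 ^ (i + 2) + 1) % 4 ≠ 3 := by
    rw [pow_succ, pow_succ]
    omega
  rw [haarSwap, if_neg h, log_two_pow_add_one, if_pos ⟨rfl, by rw [pow_succ, pow_succ]; omega⟩,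
    Nat.add_sub_cancel]

theorem haarSwap_involutive : Function.Involutive haarSwap := by
  intro m
  by_cases h1 : m % 4 = 3
  · obtain ⟨i, rfl⟩ : ∃ i, m = 4 * i + 3 := ⟨m / 4, by omega⟩
    rw [haarSwap_four_mul_add_three, haarSwap_two_pow_add_one]
  by_cases h2 : m = 2 ^ Nat.log 2 m + 1 ∧ 5 ≤ m
  · obtain ⟨i, hi⟩ : ∃ i, Nat.log 2 m = i + 2 :=
      ⟨Nat.log 2 m - 2, (Nat.sub_add_cancel (Nat.le_log_of_pow_le one_lt_two (by omega))).symm⟩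
    have hm : m = 2 ^ (i + 2) + 1 := hi ▸ h2.1
    rw [hm, haarSwap_two_pow_add_one, haarSwap_four_mul_add_three]
  · have : haarSwap m = m := by rw [haarSwap, if_neg h1, if_neg h2]
    rw [this, this]

theorem haarSwap_of_even {m : ℕ} (hm : Even m) : haarSwap m = m := by
  rw [haarSwap, if_neg (by rcases hm with ⟨a, rfl⟩; omega), if_neg]
  rintro ⟨h1, h2⟩
  have h3 : Even (2 ^ Nat.log 2 m) := by
    refine (Nat.even_pow.2 ⟨even_two, fun h0 => ?_⟩)
    rw [h0] at h1
    omega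
  have h4 := h3.add_one
  rw [← h1] at h4
  exact (Nat.not_even_iff_odd.2 h4) hm

/-- The permutation of the Haar system: it moves disjointly supported Haar functions to the
positions `4 * i + 3`. -/
def haarPerm : Equiv.Perm ℕ := haarSwap_involutive.toPerm

theorem haarSupport_two_pow_add_one (i : ℕ) :
    haarSupport (2 ^ (i + 2) + 1) = Ico ((2 ^ (i + 2))⁻¹ : ℝ) (2 * (2 ^ (i + 2))⁻¹) := by
  rw [haarSupport, haarPos, log_two_pow_add_one, Nat.add_sub_cancel_left, dyadic]
  push_cast
  congr 1
  · rw [one_div]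
  · rw [one_add_one_eq_two, div_eq_mul_inv]

theorem disjoint_haarSupport_two_pow_add_one {i j : ℕ} (hij : i ≠ j) :
    Disjoint (haarSupport (2 ^ (i + 2) + 1)) (haarSupport (2 ^ (j + 2) + 1)) := by
  wlog h : i < j generalizing i j
  · exact (this hij.symm (by omega)).symm
  rw [disjoint_left]
  intro x hx hx'
  rw [haarSupport_two_pow_add_one] at hx hx'
  have h1 : (2 : ℝ) * (2 ^ (j + 2))⁻¹ ≤ (2 ^ (i + 2))⁻¹ := by
    rw [show j + 2 = j + 1 + 1 by ring, pow_succ (2 : ℝ) (j + 1), mul_inv, mul_left_comm,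
      mul_inv_cancel₀ two_ne_zero, mul_one]
    exact inv_anti₀ (by positivity) (pow_le_pow_right₀ one_le_two (by omega))
  exact absurd (hx'.2.trans_le h1) (not_lt.2 hx.1)

/-! ### Failure of `R`-boundedness -/

theorem abs_rademacher_le (k : ℕ) (t : ℝ) : |rademacher k t| ≤ 1 := by
  rw [rademacher]
  rcases Real.sign_apply_eq (Real.sin (2 ^ k * Real.pi * t)) with h | h | h <;> rw [h] <;> norm_num

theorem ae_abs_rademacher_eq_one (k : ℕ) : ∀ᵐ t ∂unitVolume, |rademacher k t| = 1 := by
  have hc : (range fun m : ℤ => (m : ℝ) / 2 ^ k).Countable := countable_range _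
  filter_upwards [ae_restrict_of_ae (hc.ae_notMem volume)] with t ht
  have hne : Real.sin (2 ^ k * Real.pi * t) ≠ 0 := fun h => by
    obtain ⟨m, hm⟩ := Real.sin_eq_zero_iff.1 h
    refine ht ⟨m, (div_eq_iff (by positivity)).2 (mul_left_cancel₀ Real.pi_pos.ne' ?_)⟩
    linarith
  rw [rademacher]
  rcases Real.sign_apply_eq_of_ne_zero _ hne with h | h <;> simp [h]

/-- The total mass of the supports of the Haar functions with indices `4 * k + 2`, `k < N`. -/
noncomputable def haarMass (N : ℕ) : ℝ := ∑ k ∈ Finset.range N, ((2 : ℝ) ^ Nat.log 2 (4 * k + 2))⁻¹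

theorem haarMass_nonneg (N : ℕ) : 0 ≤ haarMass N := Finset.sum_nonneg fun k _ => by positivity

theorem tendsto_haarMass : Tendsto haarMass atTop atTop := by
  refine tendsto_atTop_mono (fun N => ?_)
    (Real.tendsto_sum_range_one_div_nat_succ_atTop.const_mul_atTop
      (show (0 : ℝ) < 1 / 4 by norm_num))
  rw [haarMass, Finset.mul_sum]
  refine Finset.sum_le_sum fun k _ => ?_
  have h1 : ((2 : ℝ) ^ Nat.log 2 (4 * k + 2)) ≤ 4 * (k + 1) := by
    have : 2 ^ Nat.log 2 (4 * k + 2) ≤ 4 * k + 2 := Nat.pow_log_le_self 2 (by omega)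
    calc ((2 : ℝ) ^ Nat.log 2 (4 * k + 2)) ≤ ((4 * k + 2 : ℕ) : ℝ) := by exact_mod_cast this
      _ ≤ _ := by push_cast; linarith
  rw [one_div_mul_one_div, one_div]
  exact inv_anti₀ (by positivity) h1

/-- For `p > 2` the `ℓ_2` norm is not dominated by the `ℓ_p` norm. -/
theorem exists_mul_haarMass_rpow_lt {p : ℝ≥0∞} (hp2 : 2 < p) (hp : p ≠ ∞) (D : ℝ) :
    ∃ N, D * haarMass N ^ p.toReal⁻¹ < √(haarMass N) := by
  have hr : 2 < p.toReal := by
    simpa using (ENNReal.toReal_lt_toReal (by simp) hp).2 hp2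
  have hexp : 0 < 1 / 2 - p.toReal⁻¹ := by
    rw [sub_pos, one_div]
    exact inv_strictAnti₀ two_pos hr
  obtain ⟨N, hN, hN0⟩ := ((((tendsto_rpow_atTop hexp).comp
    tendsto_haarMass).eventually_gt_atTop D).and (tendsto_haarMass.eventually_gt_atTop 0)).exists
  refine ⟨N, ?_⟩
  rw [Real.sqrt_eq_rpow, show (1 : ℝ) / 2 = (1 / 2 - p.toReal⁻¹) + p.toReal⁻¹ by ring,
    Real.rpow_add hN0]
  exact mul_lt_mul_of_pos_right hN (Real.rpow_pos_of_pos hN0 _)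

section Failure

variable {p : ℝ≥0∞} [Fact (1 ≤ p)]

theorem norm_sum_smul_normalizedHaar_le (hp : p ≠ ∞) {ρ : ℕ → ℝ} (hρ : ∀ k, |ρ k| ≤ 1) (N : ℕ) :
    ‖∑ k ∈ Finset.range N, (ρ k : ℂ) • (‖haarLp p (4 * k + 2)‖ : ℂ) •
      normalizedHaar p (2 ^ (k + 2) + 1)‖ ≤ haarMass N ^ p.toReal⁻¹ := by
  have hpos : 0 < p.toReal := ENNReal.toReal_pos exponent_ne_zero hp
  simp only [smul_smul]
  rw [Real.le_rpow_inv_iff_of_pos (norm_nonneg _)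
      (haarMass_nonneg N) hpos,
    norm_sum_smul_normalizedHaar_of_disjoint (d := fun k => 2 ^ (k + 2) + 1) hp
      (fun k => by positivity) (fun k l hkl => disjoint_haarSupport_two_pow_add_one hkl), haarMass]
  refine Finset.sum_le_sum fun k _ => ?_
  rw [← norm_haarLp_rpow hp, norm_mul, Complex.norm_real, Complex.norm_real, norm_norm,
    Real.norm_eq_abs]
  exact Real.rpow_le_rpow (by positivity) (mul_le_of_le_one_left (norm_nonneg _) (hρ k)) hpos.le

theorem sqrt_haarMass_le (hp2 : 2 ≤ p) {ρ : ℕ → ℝ} (hρ : ∀ k, |ρ k| = 1) (N : ℕ) :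
    √(haarMass N) ≤ ‖∑ k ∈ Finset.range N, (ρ k : ℂ) • haarLp p (4 * k + 2)‖ := by
  refine Real.sqrt_le_iff.2 ⟨norm_nonneg _, ?_⟩
  refine le_trans (le_of_eq ?_) (sum_sq_le_norm_sum_smul_haarLp_sq hp2
    (n := fun k => 4 * k + 2) (fun k l hkl => by simpa using hkl) _ ρ)
  refine Finset.sum_congr rfl fun k _ => ?_
  rw [← sq_abs, hρ, one_pow, one_mul]

/-- The `R`-bound of the operators `z R(z, A)` at the points `z = -2 ^ (m + 1)` would dominate the
`ℓ_2` norm by the `ℓ_p` norm. -/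
theorem sqrt_haarMass_le_of_rademacherNorm_le (hp2 : 2 ≤ p) (hp : p ≠ ∞) {q : ℝ≥0∞} (hq : 1 ≤ q)
    {C : ℝ≥0} {T : ℕ → LpUnit p →L[ℂ] LpUnit p}
    (hT : ∀ k, T k (normalizedHaar p (2 ^ (k + 2) + 1)) =
      (2⁻¹ : ℂ) • normalizedHaar p (2 ^ (k + 2) + 1) -
        (6⁻¹ : ℂ) • normalizedHaar p (4 * k + 2))
    (hR : ∀ (n : ℕ) (x : Fin n → LpUnit p), rademacherNorm q (fun k : Fin n => T k (x k)) ≤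
      C * rademacherNorm q x) (N : ℕ) :
    √(haarMass N) ≤ (6 * C + 3) * haarMass N ^ p.toReal⁻¹ := by
  have hq0 : q ≠ 0 := (zero_lt_one.trans_le hq).ne'
  set B := haarMass N ^ p.toReal⁻¹ with hB
  have hB0 : 0 ≤ B := Real.rpow_nonneg (haarMass_nonneg N) _
  set y : ℕ → LpUnit p := fun k =>
    (‖haarLp p (4 * k + 2)‖ : ℂ) • normalizedHaar p (2 ^ (k + 2) + 1) with hy
  have hTy : ∀ k, T k (y k) = (2⁻¹ : ℂ) • y k - (6⁻¹ : ℂ) • haarLp p (4 * k + 2) := fun k => by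
    rw [hy]
    simp only
    rw [map_smul, hT, smul_sub, smul_comm _ (2⁻¹ : ℂ), smul_comm _ (6⁻¹ : ℂ),
      ← haarLp_eq_smul_normalizedHaar hp]
  have hupper : rademacherNorm q (fun k : Fin N => y k) ≤ ENNReal.ofReal B := by
    refine (eLpNorm_le_of_ae_bound (C := B) (Eventually.of_forall fun t => ?_)).trans_eq
      (by simp)
    rw [← Finset.sum_range fun k => (rademacher (k + 1) t : ℂ) • y k]
    exact norm_sum_smul_normalizedHaar_le hp (fun k => abs_rademacher_le (k + 1) t) N
  have hlower : ENNReal.ofReal (√(haarMass N) / 6 - B / 2) ≤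
      rademacherNorm q (fun k : Fin N => T k (y k)) := by
    rcases le_total (√(haarMass N) / 6 - B / 2) 0 with h0 | h0
    · rw [ENNReal.ofReal_of_nonpos h0]
      exact zero_le
    have hconst : eLpNorm (fun _ : ℝ => √(haarMass N) / 6 - B / 2) q unitVolume =
        ENNReal.ofReal (√(haarMass N) / 6 - B / 2) := by
      rw [eLpNorm_const _ hq0 (IsProbabilityMeasure.ne_zero _), measure_univ, ENNReal.one_rpow,
        mul_one, Real.enorm_of_nonneg h0]
    rw [← hconst]
    refine eLpNorm_mono_ae ?_
    filter_upwards [ae_all_iff.2 fun k : ℕ => ae_abs_rademacher_eq_one (k + 1)] with t ht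
    rw [← Finset.sum_range fun k => (rademacher (k + 1) t : ℂ) • T k (y k),
      Real.norm_of_nonneg h0]
    have hsum : ∑ k ∈ Finset.range N, (rademacher (k + 1) t : ℂ) • T k (y k) =
        (2⁻¹ : ℂ) • ∑ k ∈ Finset.range N, (rademacher (k + 1) t : ℂ) • y k -
        (6⁻¹ : ℂ) • ∑ k ∈ Finset.range N, (rademacher (k + 1) t : ℂ) • haarLp p (4 * k + 2) := by
      simp only [hTy, Finset.smul_sum, ← Finset.sum_sub_distrib, smul_sub]
      exact Finset.sum_congr rfl fun k _ => by rw [smul_comm, smul_comm (6⁻¹ : ℂ)]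
    have h1 := norm_sum_smul_normalizedHaar_le hp (fun k => abs_rademacher_le (k + 1) t) N
    have h2 := sqrt_haarMass_le hp2 ht N
    have h3 := norm_sub_norm_le
      ((6⁻¹ : ℂ) • ∑ k ∈ Finset.range N, (rademacher (k + 1) t : ℂ) • haarLp p (4 * k + 2))
      ((2⁻¹ : ℂ) • ∑ k ∈ Finset.range N, (rademacher (k + 1) t : ℂ) • y k)
    rw [norm_sub_rev, ← hsum, norm_smul, norm_smul, norm_inv, norm_inv, Complex.norm_ofNat,
      Complex.norm_ofNat] at h3
    linarith
  have h := hlower.trans ((hR N fun k => y k).trans (mul_le_mul_right hupper _))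
  rw [← ENNReal.ofReal_coe_nnreal, ← ENNReal.ofReal_mul C.coe_nonneg,
    ENNReal.ofReal_le_ofReal_iff (mul_nonneg C.coe_nonneg hB0)] at h
  linarith

theorem norm_haarBasis (hp2 : 2 ≤ p) (hp : p ≠ ∞) (σ : Equiv.Perm ℕ) (m : ℕ) :
    ‖haarBasis hp2 hp σ m‖ = 1 := norm_normalizedHaar hp _

theorem not_isRSectorial_schauderMultiplier (hp2 : 2 < p) (hp : p ≠ ∞)
    (hangle : sectorialAngle (schauderMultiplier
      (pairedBasis (haarBasis hp2.le hp haarPerm) (norm_haarBasis hp2.le hp haarPerm))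
      fun m => ((2 ^ (m + 1) : ℝ) : ℂ)) = 0) :
    ¬ IsRSectorial (schauderMultiplier
      (pairedBasis (haarBasis hp2.le hp haarPerm) (norm_haarBasis hp2.le hp haarPerm))
      fun m => ((2 ^ (m + 1) : ℝ) : ℂ)) := by
  rintro ⟨-, ω, hω, q, hq, -, C, hC⟩
  rw [hangle] at hω
  obtain ⟨N, hN⟩ := exists_mul_haarMass_rpow_lt hp2 hp (6 * C + 3)
  refine absurd (sqrt_haarMass_le_of_rademacherNorm_le hp2.le hp hq (C := C)
    (T := fun k => (-((2 ^ (4 * k + 3 + 1) : ℝ) : ℂ)) • resolventOp (schauderMultiplier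
      (pairedBasis (haarBasis hp2.le hp haarPerm) (norm_haarBasis hp2.le hp haarPerm))
      fun m => ((2 ^ (m + 1) : ℝ) : ℂ)) (-((2 ^ (4 * k + 3 + 1) : ℝ) : ℂ)))
    (fun k => ?_) (fun n x => ?_) N) (not_le.2 hN)
  · have hodd : ¬ Even (4 * k + 3) := by
      rw [Nat.not_even_iff_odd]
      exact ⟨2 * k + 1, by ring⟩
    have h := smul_resolventOp_pairedBasis_apply (haarBasis hp2.le hp haarPerm)
      (norm_haarBasis hp2.le hp haarPerm) hodd
    have h1 : haarPerm (4 * k + 3) = 2 ^ (k + 2) + 1 := haarSwap_four_mul_add_three k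
    have h2 : haarPerm (4 * k + 3 - 1) = 4 * k + 2 :=
      haarSwap_of_even ⟨2 * k + 1, by omega⟩
    rw [haarBasis_apply, haarBasis_apply, h1, h2] at h
    exact h
  · exact hC n _ x fun k => ⟨_, neg_ofReal_notMem_closure_sector hω.1.le hω.2 (by positivity), rfl⟩

end Failure

end SectorialOperators

open SectorialOperators in
theorem mainTheorem1 (p : ℝ≥0∞) [Fact (1 ≤ p)] (hp2 : 2 < p) (hp : p ≠ ∞) :
    ∃ A : LpUnit p →ₗ.[ℂ] LpUnit p,
      IsSectorial A ∧ sectorialAngle A = 0 ∧ ¬ IsRSectorial A ∧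
      -- `A` is a Schauder multiplier: indices start at `0`, so the even indices here are
      -- the odd ones of an enumeration starting at `1`
      ∃ (σ : Equiv.Perm ℕ) (h f : SchauderBasis ℂ (LpUnit p)),
        (∀ m, Even m → σ m = m) ∧
        (∀ m, h m = normalizedHaar p (σ m)) ∧
        (∀ m, f m = if Even m then h m else h m + h (m - 1)) ∧
        A = schauderMultiplier f (fun m => (2 : ℂ) ^ (m + 1)) := by
  set h := haarBasis hp2.le hp haarPerm
  set f := pairedBasis h (norm_haarBasis hp2.le hp haarPerm)
  have h0 : (0 : ℝ) < 2 ^ (0 + 1) := by norm_num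
  have hmono : Monotone fun m : ℕ => (2 : ℝ) ^ (m + 1) := fun a b hab =>
    pow_le_pow_right₀ one_le_two (by omega)
  have htop : Filter.Tendsto (fun m : ℕ => (2 : ℝ) ^ (m + 1)) Filter.atTop Filter.atTop :=
    (Filter.tendsto_add_atTop_iff_nat 1).2 (tendsto_pow_atTop_atTop_of_one_lt one_lt_two)
  have hangle := sectorialAngle_schauderMultiplier f h0 hmono htop
  refine ⟨schauderMultiplier f fun m => ((2 ^ (m + 1) : ℝ) : ℂ),
    isSectorial_schauderMultiplier f h0 hmono htop, hangle,
    not_isRSectorial_schauderMultiplier hp2 hp hangle, haarPerm, h, f,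
    fun m hm => haarSwap_of_even hm, fun m => haarBasis_apply hp2.le hp haarPerm m,
    fun m => pairedBasis_apply _ _ m, ?_⟩
  congr 1
  funext m
  push_cast
  rfl
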